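/- Let $d\ge 3$, let $\mathbb B^d$ and $\mathbb S^{d-1}$ be the open unit ball and the unit sphere of $\mathbb R^d$, with surface measure $\sigma$ on $\mathbb S^{d-1}$, and let $V:(0,1)\to\mathbb C$ be measurable with $\int_0^1 r|V(r)|\,dr<\infty$. For $m\in\mathbb N_0$ let $\mathcal H_m(\mathbb S^{d-1})$ be the space of restrictions to $\mathbb S^{d-1}$ of the complex homogeneous harmonic polynomials of degree $m$ on $\mathbb R^d$, let $d_m$ be its dimension, and put $\ell_m=m+\frac{d-3}{2}$. Let $$y_m=\sum_{k=0}^\infty\psi_k^{\ell_m},\qquad \psi_0^{\ell}(r)=r^{\ell+1},\qquad \psi_k^{\ell}(r)=\int_0^r\frac{1}{2\ell+1}\Big(\frac{r^{\ell+1}}{s^{\ell}}-\frac{s^{\ell+1}}{r^{\ell}}\Big)V(s)\psi_{k-1}^{\ell}(s)\,ds\quad(k\ge 1)$$ (the regular solution of $-y''+\frac{\ell_m(\ell_m+1)}{r^2}y+Vy=0$ on $(0,1)$, $y\sim r^{\ell_m+1}$ as $r\to0^+$), and let $\alpha_m(r)=y_m(r)/r^{\ell_m+1}$ for $0<r<1$.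 A formal spherical polynomial of degree $m$ is a function on $\mathbb B^d$ of the form $U(r\xi)=r^m\alpha_m(r)p(\xi)$, $0<r<1$, $\xi\in\mathbb S^{d-1}$, with $p\in\mathcal H_m(\mathbb S^{d-1})$; let $\mathcal S_m(\mathbb B^d)$ be the set of all of them (functions being identified when they agree almost everywhere). The inner product of $W^{1,2}(\mathbb B^d)$ is $\langle u,v\rangle=\int_{\mathbb B^d}u\overline v+\int_{\mathbb B^d}\nabla u\cdot\overline{\nabla v}$. Then $\mathcal S_m(\mathbb B^d)\subset W^{1,2}(\mathbb B^d)$ for every $m\in\mathbb N_0$, and: (i) if $m\ne n$, then $\mathcal S_m(\mathbb B^d)\perp\mathcal S_n(\mathbb B^d)$ in $W^{1,2}(\mathbb B^d)$; (ii) for every $m\in\mathbb N_0$ and every basis $Y_1^{(m)},\dots,Y_{d_m}^{(m)}$ of $\mathcal H_m(\mathbb S^{d-1})$ that is orthonormal in $L^2(\mathbb S^{d-1},\sigma)$, the functions $\mathcal V_j^{(m)}(r\xi)=r^m\alpha_m(r)Y_j^{(m)}(\xi)$, $j=1,\dots,d_m$, form a basis of the vector space $\mathcal S_m(\mathbb B^d)$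 that is orthogonal with respect to the inner product of $W^{1,2}(\mathbb B^d)$. -/

import Mathlib

open MeasureTheory Metric
open scoped ContDiff ComplexConjugate

noncomputable section

namespace FormalSpherical

/-- Euclidean space `ℝ^d`. -/
abbrev Rd (d : ℕ) : Type := EuclideanSpace ℝ (Fin d)

/-- The unit sphere `S^{d-1}` of `ℝ^d`. -/
abbrev Sph (d : ℕ) : Type := sphere (0 : Rd d) 1

/-- Lebesgue measure on the open unit ball `B^d`. -/
abbrev ballMeasure (d : ℕ) : Measure (Rd d) :=
  (volume : Measure (Rd d)).restrict (ball 0 1)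

/-- The (unnormalized) surface measure `σ` on `S^{d-1}`. -/
abbrev surfaceMeasure (d : ℕ) : Measure (Sph d) :=
  (volume : Measure (Rd d)).toSphere

/-! ### The Sobolev space `W^{1,2}(B^d)` -/

/-- `g` is the weak (distributional) partial derivative `∂u/∂x_i` on the unit ball. Testing with
real valued test functions is the same as testing with complex valued ones, by linearity. -/
def IsWeakPartial (d : ℕ) (i : Fin d) (u g : Rd d → ℂ) : Prop :=
  ∀ φ : Rd d → ℝ, ContDiff ℝ ∞ φ → HasCompactSupport φ → tsupport φ ⊆ ball 0 1 →
    ∫ x, fderiv ℝ φ x (EuclideanSpace.single i 1) • u x ∂(ballMeasure d) =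
      -∫ x, φ x • g x ∂(ballMeasure d)

/-- `L²(B^d; ℂ)`. -/
abbrev L2Ball (d : ℕ) : Type := Lp ℂ 2 (ballMeasure d)

theorem integrable_smul_L2 (d : ℕ) {φ : Rd d → ℝ} (hφ : Continuous φ) (hs : HasCompactSupport φ)
    (u : L2Ball d) : Integrable (fun x => φ x • u x) (ballMeasure d) := by
  have : IsFiniteMeasure (ballMeasure d) :=
    ⟨by rw [Measure.restrict_apply_univ]; exact measure_ball_lt_top⟩
  have hu : Integrable (fun x => u x) (ballMeasure d) :=
    (Lp.memLp u).integrable (by norm_num)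
  obtain ⟨C, hC⟩ := hs.exists_bound_of_continuous hφ
  exact hu.bdd_smul C hφ.aestronglyMeasurable (Filter.Eventually.of_forall hC)

/-- The pairs `(u, ∇u)` with `u ∈ L²(B^d)` and all weak partial derivatives `∂u/∂x_i` in `L²(B^d)`,
as a subspace of the Hilbert sum `L² ⊕ (L²)^d`. -/
def sobolevGraph (d : ℕ) :
    Submodule ℂ (WithLp 2 (L2Ball d × PiLp 2 (fun _ : Fin d => L2Ball d))) where
  carrier := {f | ∀ i, IsWeakPartial d i f.fst (f.snd i)}
  zero_mem' := by
    intro i φ _ _ _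
    have h : ((0 : L2Ball d) : Rd d → ℂ) =ᵐ[ballMeasure d] 0 := Lp.coeFn_zero _ _ _
    have h1 (a : Rd d → ℝ) : ∫ x, a x • (0 : L2Ball d) x ∂(ballMeasure d) = 0 :=
      integral_eq_zero_of_ae (by filter_upwards [h] with x hx; rw [hx]; simp)
    exact (h1 _).trans (by rw [← neg_zero, ← h1 φ]; rfl)
  add_mem' := by
    intro f g hf hg i φ hφ hc hs
    have hd : Continuous fun x => fderiv ℝ φ x (EuclideanSpace.single i 1) :=
      (hφ.continuous_fderiv (by simp)).clm_apply continuous_const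
    have hdc : HasCompactSupport fun x => fderiv ℝ φ x (EuclideanSpace.single i 1) :=
      hc.fderiv_apply ℝ _
    have e1 : ∫ x, fderiv ℝ φ x (EuclideanSpace.single i 1) • (f + g).fst x ∂(ballMeasure d) =
        ∫ x, fderiv ℝ φ x (EuclideanSpace.single i 1) • f.fst x ∂(ballMeasure d) +
        ∫ x, fderiv ℝ φ x (EuclideanSpace.single i 1) • g.fst x ∂(ballMeasure d) := by
      rw [← integral_add (integrable_smul_L2 d hd hdc _) (integrable_smul_L2 d hd hdc _)]
      refine integral_congr_ae ?_
      filter_upwards [Lp.coeFn_add f.fst g.fst] with x hx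
      simp only [WithLp.add_fst, hx, Pi.add_apply, smul_add]
    have e2 : ∫ x, φ x • (f + g).snd i x ∂(ballMeasure d) =
        ∫ x, φ x • f.snd i x ∂(ballMeasure d) + ∫ x, φ x • g.snd i x ∂(ballMeasure d) := by
      rw [← integral_add (integrable_smul_L2 d hφ.continuous hc _)
        (integrable_smul_L2 d hφ.continuous hc _)]
      refine integral_congr_ae ?_
      filter_upwards [Lp.coeFn_add (f.snd i) (g.snd i)] with x hx
      simp only [WithLp.add_snd, PiLp.add_apply, hx, Pi.add_apply, smul_add]
    rw [e1, e2, hf i φ hφ hc hs, hg i φ hφ hc hs]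
    ring
  smul_mem' := by
    intro c f hf i φ hφ hc hs
    have e1 : ∫ x, fderiv ℝ φ x (EuclideanSpace.single i 1) • (c • f).fst x ∂(ballMeasure d) =
        c * ∫ x, fderiv ℝ φ x (EuclideanSpace.single i 1) • f.fst x ∂(ballMeasure d) := by
      rw [← integral_const_mul]
      refine integral_congr_ae ?_
      filter_upwards [Lp.coeFn_smul c f.fst] with x hx
      simp only [WithLp.smul_fst, hx, Pi.smul_apply, smul_eq_mul, Complex.real_smul]
      ring
    have e2 : ∫ x, φ x • (c • f).snd i x ∂(ballMeasure d) =
        c * ∫ x, φ x • f.snd i x ∂(ballMeasure d) := by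
      rw [← integral_const_mul]
      refine integral_congr_ae ?_
      filter_upwards [Lp.coeFn_smul c (f.snd i)] with x hx
      simp only [WithLp.smul_snd, PiLp.smul_apply, hx, Pi.smul_apply, smul_eq_mul,
        Complex.real_smul]
      ring
    rw [e1, e2, hf i φ hφ hc hs]
    ring

/-- The Sobolev space `W^{1,2}(B^d)` of complex valued functions: a function `u ∈ L²(B^d)` with weak
gradient in `L²` is encoded as the pair `(u, ∇u)`. -/
def W12 (d : ℕ) : Type := sobolevGraph d

instance (d : ℕ) : NormedAddCommGroup (W12 d) := inferInstanceAs (NormedAddCommGroup (sobolevGraph d))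

instance (d : ℕ) : InnerProductSpace ℂ (W12 d) :=
  inferInstanceAs (InnerProductSpace ℂ (sobolevGraph d))

/-- The underlying `L²` function `u` of an element of `W^{1,2}(B^d)`. -/
def W12.fn {d : ℕ} (f : W12 d) : L2Ball d :=
  (show sobolevGraph d from f).1.fst

/-- The weak partial derivative `∂u/∂x_i` of an element of `W^{1,2}(B^d)`. -/
def W12.grad {d : ℕ} (f : W12 d) (i : Fin d) : L2Ball d :=
  (show sobolevGraph d from f).1.snd i

theorem W12.isWeakPartial {d : ℕ} (f : W12 d) (i : Fin d) : IsWeakPartial d i f.fn (f.grad i) :=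
  (show sobolevGraph d from f).2 i

theorem W12.fn_zero (d : ℕ) : (0 : W12 d).fn = 0 := rfl

theorem W12.fn_add {d : ℕ} (f g : W12 d) : (f + g).fn = f.fn + g.fn := rfl

theorem W12.fn_smul {d : ℕ} (c : ℂ) (f : W12 d) : (c • f).fn = c • f.fn := rfl

/-- The inner product of `W^{1,2}(B^d)` (Mathlib's convention is conjugate linear in the first
variable). -/
theorem W12.inner_eq {d : ℕ} (f g : W12 d) :
    inner ℂ f g = ∫ x, g.fn x * conj (f.fn x) ∂(ballMeasure d) +
      ∑ i, ∫ x, g.grad i x * conj (f.grad i x) ∂(ballMeasure d) := by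
  have h : inner ℂ f g = inner ℂ f.fn g.fn + ∑ i, inner ℂ (f.grad i) (g.grad i) := by
    change inner ℂ (show sobolevGraph d from f).1 (show sobolevGraph d from g).1 = _
    rw [WithLp.prod_inner_apply, PiLp.inner_apply]
    rfl
  rw [h]
  simp only [L2.inner_def, RCLike.inner_apply]

/-- `f ∈ W^{1,2}(B^d)` is (the a.e. class of) the function `u` on the ball. -/
def W12.Represents {d : ℕ} (f : W12 d) (u : Rd d → ℂ) : Prop :=
  (f.fn : Rd d → ℂ) =ᵐ[ballMeasure d] u

/-! ### Spherical harmonics -/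

/-- The space `H_m(ℝ^d)` of homogeneous harmonic polynomials of degree `m` in `d` variables with
complex coefficients. -/
def harmonicPolynomials (d m : ℕ) : Submodule ℂ (MvPolynomial (Fin d) ℂ) :=
  MvPolynomial.homogeneousSubmodule (Fin d) ℂ m ⊓
    LinearMap.ker (∑ i : Fin d,
      ((MvPolynomial.pderiv i : Derivation ℂ (MvPolynomial (Fin d) ℂ) (MvPolynomial (Fin d) ℂ)) :
        MvPolynomial (Fin d) ℂ →ₗ[ℂ] MvPolynomial (Fin d) ℂ) ^ 2)

/-- Restriction of a polynomial to the unit sphere. -/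
def restrictSphere (d : ℕ) : MvPolynomial (Fin d) ℂ →ₗ[ℂ] (Sph d → ℂ) where
  toFun P ξ := MvPolynomial.eval (fun i => ((ξ : Rd d) i : ℂ)) P
  map_add' P Q := by ext ξ; simp
  map_smul' c P := by ext ξ; simp [MvPolynomial.smul_eval]

/-- The space `H_m(S^{d-1})` of spherical harmonics of degree `m`. -/
def sphericalHarmonics (d m : ℕ) : Submodule ℂ (Sph d → ℂ) :=
  (harmonicPolynomials d m).map (restrictSphere d)

/-- `Y` is orthonormal in `L²(S^{d-1})`. -/
def IsOrthonormalOnSphere (d : ℕ) {ι : Type*} [DecidableEq ι] (Y : ι → Sph d → ℂ) : Prop :=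
  ∀ j k, ∫ ξ, Y j ξ * conj (Y k ξ) ∂(surfaceMeasure d) = if j = k then 1 else 0

/-! ### The regular solution of the perturbed Bessel equation -/

/-- The kernel `L_ℓ(r, s)`. -/
def besselKernel (l r s : ℝ) : ℝ :=
  1 / (2 * l + 1) * (r ^ (l + 1) / s ^ l - s ^ (l + 1) / r ^ l)

/-- The functions `ψ_k^ℓ`: `ψ_0 = r^{ℓ+1}`, `ψ_k(r) = ∫_0^r L_ℓ(r, s) V(s) ψ_{k-1}(s) ds`. -/
def psi (V : ℝ → ℂ) (l : ℝ) : ℕ → ℝ → ℂ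
  | 0 => fun r => ((r ^ (l + 1) : ℝ) : ℂ)
  | k + 1 => fun r => ∫ s in (0 : ℝ)..r, (besselKernel l r s : ℂ) * V s * psi V l k s

/-- The regular solution `w_ℓ = ∑_k ψ_k^ℓ` of `-w'' + ℓ(ℓ+1) r⁻² w + V w = 0` on `(0,1)`. -/
def besselSol (V : ℝ → ℂ) (l r : ℝ) : ℂ := ∑' k, psi V l k r

/-- The index `ℓ_m = m + (d-3)/2`. -/
def ell (d m : ℕ) : ℝ := m + ((d : ℝ) - 3) / 2

/-- The radial factor `α_m(r) = y_m(r) / r^{ℓ_m+1}`, `0 < r < 1`, where `y_m = w_{ℓ_m}`. -/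
def alpha (d : ℕ) (V : ℝ → ℂ) (m : ℕ) (r : ℝ) : ℂ :=
  besselSol V (ell d m) r / ((r ^ (ell d m + 1) : ℝ) : ℂ)

/-! ### Formal spherical polynomials -/

/-- The direction `ξ = x / |x|` of a nonzero vector. -/
def direction {d : ℕ} (x : Rd d) (hx : x ≠ 0) : Sph d :=
  ⟨‖x‖⁻¹ • x, by simp [norm_smul, hx]⟩

open Classical in
/-- The function `x = rξ ↦ r^m α_m(r) p(ξ)`; its value at the single point `x = 0`, where `ξ` is
not defined, is irrelevant. -/
def formalPolynomial (d : ℕ) (V : ℝ → ℂ) (m : ℕ) (p : Sph d → ℂ) (x : Rd d) : ℂ :=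
  if hx : x = 0 then 0 else (‖x‖ : ℂ) ^ m * alpha d V m ‖x‖ * p (direction x hx)

theorem formalPolynomial_add (d : ℕ) (V : ℝ → ℂ) (m : ℕ) (p q : Sph d → ℂ) :
    formalPolynomial d V m (p + q) = formalPolynomial d V m p + formalPolynomial d V m q := by
  ext x
  by_cases hx : x = 0 <;> simp [formalPolynomial, hx, mul_add]

theorem formalPolynomial_smul (d : ℕ) (V : ℝ → ℂ) (m : ℕ) (c : ℂ) (p : Sph d → ℂ) :
    formalPolynomial d V m (c • p) = c • formalPolynomial d V m p := by
  ext x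
  by_cases hx : x = 0 <;> simp [formalPolynomial, hx]
  ring

/-- The space `S_m(B^d)` of formal spherical polynomials of degree `m`, as a subspace of
`W^{1,2}(B^d)`. -/
def formalSpace (d : ℕ) (V : ℝ → ℂ) (m : ℕ) : Submodule ℂ (W12 d) where
  carrier := {f | ∃ p ∈ sphericalHarmonics d m, f.Represents (formalPolynomial d V m p)}
  zero_mem' := by
    refine ⟨0, zero_mem _, ?_⟩
    have h0 : formalPolynomial d V m 0 = 0 := by
      simpa using formalPolynomial_smul d V m 0 0
    rw [h0]
    exact Lp.coeFn_zero _ _ _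
  add_mem' := by
    rintro f g ⟨p, hp, hf⟩ ⟨q, hq, hg⟩
    refine ⟨p + q, add_mem hp hq, ?_⟩
    rw [formalPolynomial_add]
    exact (Lp.coeFn_add f.fn g.fn).trans (hf.add hg)
  smul_mem' := by
    rintro c f ⟨p, hp, hf⟩
    refine ⟨c • p, Submodule.smul_mem _ c hp, ?_⟩
    rw [formalPolynomial_smul]
    exact (Lp.coeFn_smul c f.fn).trans (hf.const_smul c)

end FormalSpherical

end

/-! Put `q = 2ℓ_m + 1 = 2m + d - 2`, a positive integer, and `f(s) = s V(s)` on `(0,1)`, extended by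
zero. Dividing the recursion for `ψ_k` by `r^(ℓ+1)` turns it into `a_0 = 1`, `a_(k+1)(r) = ∫_0^r q⁻¹
(1 - (s/r)^q) f(s) a_k(s) ds`. The kernel lies between `0` and `1` and `f` is integrable, so
`|a_k(r)| ≤ (∫_0^r |f|)^k / k!`. Hence `α_m = ∑ a_k` converges uniformly, is continuous with `α_m(0)
= 1`, and solves a Volterra equation. That equation gives `α_m'(r) = r^(-q-1) ∫_0^r s^q f α_m`, so
`|α_m'(r)| ≤ C / r` for `r > 0`.

If `p` is the restriction of the homogeneous harmonic polynomial `P`, then `U(x) = α_m(|x|) P(x)`.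
Its classical gradient off the origin is `O(1/|x|)` on the ball, which is square integrable because
`d ≥ 3`. The divergence theorem tolerates the exceptional point `0`, so this gradient is the weak
one (`isWeakPartial_formalFun`).

For orthogonality, Euler's identity reduces the Sobolev integrand on the sphere of radius `r` to
`A(r) Q P̄ + B(r) ∇Q · ∇P̄` (`exists_sobolev_integrand_eq`). If `Q P̄` has mean zero on the unit
sphere, so has `∇Q · ∇P̄` (`integral_sphere_grad_eq_zero`), and the inner product vanishes in polar
coordinates. The mean is zero for different degrees by Green's identity, and for distinct members of
an orthonormal basis by assumption.

Finally `p ↦ U` is a linear isomorphism onto `S_m`: it is injective since `α_m` is nonzero near `0`.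
It therefore carries bases to bases. -/

noncomputable section

namespace FormalSpherical

/-! ### Volterra operators with the kernel `q⁻¹ (1 - (s/r)^q)` -/

/-- The Volterra operator `g ↦ ∫_0^r q⁻¹ (1 - (s/r)^q) g(s) ds`. -/
def volterraOp (q : ℕ) (g : ℝ → ℂ) (r : ℝ) : ℂ :=
  ∫ s in (0 : ℝ)..r, (((q : ℝ)⁻¹ * (1 - (s / r) ^ q) : ℝ) : ℂ) * g s

/-- The derivative `r^{-q-1} ∫_0^r s^q g(s) ds` of `volterraOp q g`. -/
def volterraDeriv (q : ℕ) (g : ℝ → ℂ) (r : ℝ) : ℂ :=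
  ∫ s in (0 : ℝ)..r, ((r⁻¹ * (s / r) ^ q : ℝ) : ℂ) * g s

theorem volterraOp_of_nonpos {q : ℕ} {g : ℝ → ℂ} (h0 : ∀ s ≤ 0, g s = 0) {r : ℝ} (hr : r ≤ 0) :
    volterraOp q g r = 0 := by
  refine (intervalIntegral.integral_congr (g := fun _ => (0 : ℂ)) fun s hs => ?_).trans (by simp)
  rw [Set.uIcc_of_ge hr] at hs
  simp [h0 s hs.2]

theorem intervalIntegrable_continuous_mul {g : ℝ → ℂ} (hg : Integrable g) {k : ℝ → ℝ}
    (hk : Continuous k) (a b : ℝ) :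
    IntervalIntegrable (fun s => ((k s : ℝ) : ℂ) * g s) volume a b :=
  (hg.intervalIntegrable).continuousOn_mul (Complex.continuous_ofReal.comp hk).continuousOn

theorem norm_volterraOp_le {q : ℕ} (hq : 1 ≤ q) {g : ℝ → ℂ} (hg : Integrable g) {r : ℝ}
    (hr : 0 ≤ r) : ‖volterraOp q g r‖ ≤ ∫ s in (0 : ℝ)..r, ‖g s‖ := by
  refine intervalIntegral.norm_integral_le_of_norm_le hr (.of_forall fun s hs => ?_)
    hg.norm.intervalIntegrable
  have h1 : 0 ≤ s / r := div_nonneg hs.1.le hr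
  have h2 : s / r ≤ 1 := div_le_one_of_le₀ hs.2 hr
  have h3 : (s / r) ^ q ≤ 1 := pow_le_one₀ h1 h2
  have h4 : 0 ≤ (s / r) ^ q := pow_nonneg h1 q
  have h5 : (q : ℝ)⁻¹ ≤ 1 := inv_le_one_of_one_le₀ (by exact_mod_cast hq)
  rw [norm_mul, Complex.norm_real, Real.norm_eq_abs,
    abs_of_nonneg (mul_nonneg (by positivity) (by linarith))]
  refine mul_le_of_le_one_left (norm_nonneg _) ?_
  exact mul_le_one₀ h5 (by linarith) (by linarith)

theorem norm_volterraDeriv_le (q : ℕ) {g : ℝ → ℂ} (hg : Integrable g) {r : ℝ} (hr : 0 < r) :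
    ‖volterraDeriv q g r‖ ≤ r⁻¹ * ∫ s, ‖g s‖ := by
  have h : ‖volterraDeriv q g r‖ ≤ ∫ s in (0 : ℝ)..r, r⁻¹ * ‖g s‖ := by
    refine intervalIntegral.norm_integral_le_of_norm_le hr.le (.of_forall fun s hs => ?_)
      (hg.norm.const_mul _).intervalIntegrable
    have h1 : 0 ≤ s / r := div_nonneg hs.1.le hr.le
    have h3 : (s / r) ^ q ≤ 1 := pow_le_one₀ h1 (div_le_one_of_le₀ hs.2 hr.le)
    rw [norm_mul, Complex.norm_real, Real.norm_eq_abs, abs_of_nonneg (by positivity)]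
    gcongr
    exact mul_le_of_le_one_right (by positivity) h3
  refine h.trans ?_
  rw [intervalIntegral.integral_const_mul, intervalIntegral.integral_of_le hr.le]
  exact mul_le_mul_of_nonneg_left
    (setIntegral_le_integral hg.norm (.of_forall fun _ => norm_nonneg _)) (by positivity)

theorem volterraDeriv_eq (q : ℕ) (g : ℝ → ℂ) (r : ℝ) :
    volterraDeriv q g r =
      ((r⁻¹ * (r ^ q)⁻¹ : ℝ) : ℂ) * ∫ s in (0 : ℝ)..r, ((s ^ q : ℝ) : ℂ) * g s := by
  rw [volterraDeriv, ← intervalIntegral.integral_const_mul]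
  congr 1
  ext s
  push_cast
  rw [div_pow]
  ring

theorem continuousOn_volterraDeriv (q : ℕ) {g : ℝ → ℂ} (hg : Integrable g) :
    ContinuousOn (volterraDeriv q g) (Set.Ioi 0) := by
  have h : Continuous fun r : ℝ => ∫ s in (0 : ℝ)..r, ((s ^ q : ℝ) : ℂ) * g s :=
    intervalIntegral.continuous_primitive
      (intervalIntegrable_continuous_mul hg (continuous_pow q)) 0
  refine ContinuousOn.congr (f := fun r : ℝ => ((r⁻¹ * (r ^ q)⁻¹ : ℝ) : ℂ) *
    ∫ s in (0 : ℝ)..r, ((s ^ q : ℝ) : ℂ) * g s) ?_ fun r _ => volterraDeriv_eq q g r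
  refine ContinuousOn.mul ?_ h.continuousOn
  refine Complex.continuous_ofReal.comp_continuousOn ?_
  refine ContinuousOn.mul ?_ ?_
  · exact continuousOn_inv₀.mono fun x (hx : 0 < x) => hx.ne'
  · exact (continuous_pow q).continuousOn.inv₀ fun x (hx : 0 < x) => (pow_pos hx q).ne'

/-- The kernel vanishes on the diagonal: between `r` and `t` it is `O(|t - r|)`, so the integral is
`O(|t - r|)` times `∫_r^t |g| = o(1)`. This is why the derivative exists at every point although `g`
is merely integrable. -/
theorem hasDerivAt_volterra_remainder (q : ℕ) {g : ℝ → ℂ} (hg : Integrable g) {r : ℝ}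
    (hr : 0 < r) :
    HasDerivAt (fun t => ∫ s in r..t, ((1 - (s / t) ^ q : ℝ) : ℂ) * g s) 0 r := by
  have hO : (fun x : ℝ => 1 - x ^ q) =O[nhds 1] fun x => x - 1 := by
    have := ((hasDerivAt_pow q (1 : ℝ)).const_sub 1).isBigO_sub
    simpa using this
  obtain ⟨C, hC⟩ := hO.bound
  obtain ⟨δ, hδ, hb⟩ := Metric.eventually_nhds_iff.1 hC
  have hcont : Continuous fun t : ℝ => ∫ s in r..t, ‖g s‖ :=
    intervalIntegral.continuous_primitive (fun a b => hg.norm.intervalIntegrable) r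
  have ht : Filter.Tendsto (fun t : ℝ => ∫ s in r..t, ‖g s‖) (nhds r) (nhds 0) := by
    simpa using hcont.tendsto r
  rw [hasDerivAt_iff_isLittleO]
  have hbd : (fun t => (∫ s in r..t, ((1 - (s / t) ^ q : ℝ) : ℂ) * g s)) =O[nhds r]
      fun t => (t - r) * ∫ s in r..t, ‖g s‖ := by
    -- Distance below `r/2` gives `t > r/2`, hence `|s/t - 1| ≤ (2/r)|t - r|`; distance below `δ
    -- r/2` brings this under `δ`.
    refine Asymptotics.IsBigO.of_bound (|C| * (2 / r)) ?_
    filter_upwards [Metric.ball_mem_nhds r (ε := min (r / 2) (δ * (r / 2))) (by positivity)]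
      with t htr
    rw [Metric.mem_ball, Real.dist_eq, lt_min_iff] at htr
    have ht0 : r / 2 < t := by have := abs_lt.1 htr.1; linarith
    have h1 : ‖∫ s in r..t, ((1 - (s / t) ^ q : ℝ) : ℂ) * g s‖ ≤
        |∫ s in r..t, (|C| * (2 / r) * |t - r|) * ‖g s‖| := by
      refine intervalIntegral.norm_integral_le_abs_of_norm_le ?_
        (hg.norm.const_mul _).intervalIntegrable
      refine (ae_restrict_iff' measurableSet_uIoc).2 (.of_forall fun s hs => ?_)
      have hst : |s - t| ≤ |t - r| := by
        rcases le_total r t with h | h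
        · rw [Set.uIoc_of_le h] at hs
          rw [abs_of_nonpos (by linarith [hs.2]), abs_of_nonneg (by linarith)]
          linarith [hs.1]
        · rw [Set.uIoc_of_ge h] at hs
          rw [abs_of_nonneg (by linarith [hs.1]), abs_of_nonpos (by linarith)]
          linarith [hs.2]
      have htpos : 0 < t := by linarith
      have hq1 : |s / t - 1| ≤ 2 / r * |t - r| := by
        have : s / t - 1 = (s - t) / t := by field_simp
        rw [this, abs_div, abs_of_pos htpos, div_le_iff₀ htpos]
        refine hst.trans ?_
        have : 1 ≤ 2 / r * t := by
          rw [div_mul_eq_mul_div, le_div_iff₀ hr]; linarith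
        nlinarith [abs_nonneg (t - r)]
      have hq2 : dist (s / t) 1 < δ := by
        rw [Real.dist_eq]
        refine hq1.trans_lt ?_
        rw [div_mul_eq_mul_div, div_lt_iff₀ hr]
        linarith [htr.2]
      have h3 := hb hq2
      rw [norm_mul, Complex.norm_real]
      refine mul_le_mul_of_nonneg_right ?_ (norm_nonneg _)
      refine h3.trans ?_
      rw [Real.norm_eq_abs, mul_assoc]
      gcongr
      exact le_abs_self C
    refine h1.trans (le_of_eq ?_)
    rw [intervalIntegral.integral_const_mul, abs_mul, norm_mul, Real.norm_eq_abs, Real.norm_eq_abs,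
      abs_of_nonneg (by positivity : (0 : ℝ) ≤ |C| * (2 / r) * |t - r|)]
    ring
  have hlo : (fun t => (t - r) * ∫ s in r..t, ‖g s‖) =o[nhds r] fun t => t - r := by
    have := (Asymptotics.isBigO_refl (fun t : ℝ => t - r) (nhds r)).mul_isLittleO
      ((Asymptotics.isLittleO_one_iff ℝ).2 ht)
    simpa using this
  simpa using hbd.trans_isLittleO hlo

/-- Split the integral at the fixed point `r`. Over `[0, r]` the variable `t` enters only through
the factor `t^(-q)`, and the rest is the remainder with zero derivative. -/
theorem hasDerivAt_volterraOp {q : ℕ} (hq : 1 ≤ q) {g : ℝ → ℂ} (hg : Integrable g) {r : ℝ}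
    (hr : 0 < r) : HasDerivAt (volterraOp q g) (volterraDeriv q g r) r := by
  set G : ℂ := ∫ s in (0 : ℝ)..r, ((s ^ q : ℝ) : ℂ) * g s
  set A : ℂ := ∫ s in (0 : ℝ)..r, g s
  have hq0 : (q : ℝ) ≠ 0 := by positivity
  have hmain : HasDerivAt (fun t : ℝ => (((q : ℝ)⁻¹ : ℝ) : ℂ) * (A - (((t ^ q)⁻¹ : ℝ) : ℂ) * G +
      ∫ s in r..t, ((1 - (s / t) ^ q : ℝ) : ℂ) * g s)) (volterraDeriv q g r) r := by
    have h1 : HasDerivAt (fun t : ℝ => (t ^ q)⁻¹) (-(q * r ^ (q - 1)) / (r ^ q) ^ 2) r :=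
      (hasDerivAt_pow q r).inv (pow_pos hr q).ne'
    have h2 := ((((h1.ofReal_comp).mul_const G).const_sub A).add
      (hasDerivAt_volterra_remainder q hg hr)).const_mul (((q : ℝ)⁻¹ : ℝ) : ℂ)
    convert! h2 using 1
    rw [volterraDeriv_eq]
    rw [add_zero, ← neg_mul, ← mul_assoc]
    congr 1
    norm_cast
    obtain ⟨p, rfl⟩ : ∃ p, q = p + 1 := ⟨q - 1, by omega⟩
    simp only [Nat.add_sub_cancel]
    push_cast at hq0 ⊢
    field_simp
    ring
  refine hmain.congr_of_eventuallyEq ?_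
  filter_upwards [lt_mem_nhds hr] with t ht
  have e1 : volterraOp q g t = (((q : ℝ)⁻¹ : ℝ) : ℂ) *
      ∫ s in (0 : ℝ)..t, ((1 - (s / t) ^ q : ℝ) : ℂ) * g s := by
    rw [volterraOp, ← intervalIntegral.integral_const_mul]
    congr 1
    ext s
    push_cast
    ring
  have hk : Continuous fun s : ℝ => 1 - (s / t) ^ q := by fun_prop
  have e2 : ∫ s in (0 : ℝ)..r, ((1 - (s / t) ^ q : ℝ) : ℂ) * g s =
      A - (((t ^ q)⁻¹ : ℝ) : ℂ) * G := by
    rw [← intervalIntegral.integral_const_mul, ← intervalIntegral.integral_sub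
      hg.intervalIntegrable
      ((intervalIntegrable_continuous_mul hg (continuous_pow q) 0 r).const_mul _)]
    congr 1
    ext s
    push_cast
    rw [div_pow]
    ring
  rw [e1, ← intervalIntegral.integral_add_adjacent_intervals
    (intervalIntegrable_continuous_mul hg hk 0 r) (intervalIntegrable_continuous_mul hg hk r t), e2]

theorem continuous_volterraOp {q : ℕ} (hq : 1 ≤ q) {g : ℝ → ℂ} (hg : Integrable g)
    (h0 : ∀ s ≤ 0, g s = 0) : Continuous (volterraOp q g) := by
  rw [continuous_iff_continuousAt]
  intro r
  rcases lt_trichotomy r 0 with hr | rfl | hr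
  · refine (continuousAt_const (y := (0 : ℂ))).congr ?_
    filter_upwards [gt_mem_nhds hr] with t ht
    exact (volterraOp_of_nonpos h0 ht.le).symm
  · have hc : Continuous fun t : ℝ => |∫ s in (0 : ℝ)..t, ‖g s‖| :=
      (intervalIntegral.continuous_primitive (fun a b => hg.norm.intervalIntegrable) 0).abs
    rw [ContinuousAt, volterraOp_of_nonpos h0 le_rfl]
    refine squeeze_zero_norm (fun t => ?_) (by simpa using hc.tendsto 0)
    rcases le_total t 0 with ht | ht
    · rw [volterraOp_of_nonpos h0 ht]
      simp
    · exact (norm_volterraOp_le hq hg ht).trans (le_abs_self _)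
  · exact (hasDerivAt_volterraOp hq hg hr).continuousAt

/-! ### The Neumann series -/

/-- The iterates `a_0 = 1`, `a_{k+1} = volterraOp q (f a_k)`. -/
def volterraTerm (q : ℕ) (f : ℝ → ℂ) : ℕ → ℝ → ℂ
  | 0 => fun _ => 1
  | k + 1 => volterraOp q fun s => f s * volterraTerm q f k s

/-- This produces the factorials in the Neumann series. As `w` is only integrable, its primitive is
differentiable almost everywhere, so the fundamental theorem is used for absolutely continuous
functions; powers stay in that class. -/
theorem integral_mul_primitive_pow {w : ℝ → ℝ} (hw : Integrable w) (r : ℝ) (k : ℕ) :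
    ∫ s in (0 : ℝ)..r, w s * (∫ t in (0 : ℝ)..s, w t) ^ k =
      (∫ t in (0 : ℝ)..r, w t) ^ (k + 1) / (k + 1) := by
  have hac : AbsolutelyContinuousOnInterval (fun s => ∫ t in (0 : ℝ)..s, w t) 0 r :=
    hw.intervalIntegrable.absolutelyContinuousOnInterval_intervalIntegral (by simp)
  have hpow : ∀ n : ℕ, AbsolutelyContinuousOnInterval
      (fun s => (∫ t in (0 : ℝ)..s, w t) ^ (n + 1)) 0 r := by
    intro n
    induction n with
    | zero => simpa using hac
    | succ n ih =>
      simp only [pow_succ _ (n + 1)]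
      exact ih.mul hac
  have h := (hpow k).integral_deriv_eq_sub
  have hd : ∀ᵐ s, s ∈ Set.uIoc 0 r → deriv (fun s => (∫ t in (0 : ℝ)..s, w t) ^ (k + 1)) s =
      (k + 1) * (w s * (∫ t in (0 : ℝ)..s, w t) ^ k) := by
    filter_upwards [hw.intervalIntegrable.ae_hasDerivAt_integral (a := 0) (b := r)] with s hs hs'
    refine ((hs (Set.uIoc_subset_uIcc hs') 0 (by simp)).fun_pow (k + 1)).deriv.trans ?_
    simp
    ring
  rw [intervalIntegral.integral_congr_ae hd, intervalIntegral.integral_const_mul] at h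
  rw [eq_div_iff (by positivity), mul_comm, h]
  simp

section Neumann

variable {q : ℕ} {f : ℝ → ℂ}

theorem norm_primitive_le (hf : Integrable f) {r : ℝ} (hr : 0 ≤ r) :
    ∫ s in (0 : ℝ)..r, ‖f s‖ ≤ ∫ s, ‖f s‖ := by
  rw [intervalIntegral.integral_of_le hr]
  exact setIntegral_le_integral hf.norm (.of_forall fun _ => norm_nonneg _)

/-- The claims need a joint induction: continuity and the global bound make `f a_k` integrable, and
the bound by the primitive, integrated once more, gains the factor `1/(k+1)`. The global bound is
the majorant for uniform convergence. -/
theorem volterraTerm_spec (hq : 1 ≤ q) (hf : Integrable f) (h0 : ∀ s ≤ 0, f s = 0) (k : ℕ) :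
    Continuous (volterraTerm q f k) ∧
      (∀ r, 0 ≤ r → ‖volterraTerm q f k r‖ ≤ (∫ s in (0 : ℝ)..r, ‖f s‖) ^ k / k.factorial) ∧
      ∀ r, ‖volterraTerm q f k r‖ ≤ (∫ s, ‖f s‖) ^ k / k.factorial := by
  have hM : 0 ≤ ∫ s, ‖f s‖ := integral_nonneg fun _ => norm_nonneg _
  induction k with
  | zero => exact ⟨continuous_const, by simp [volterraTerm], by simp [volterraTerm]⟩
  | succ k ih =>
    obtain ⟨hc, hb, hb'⟩ := ih
    have hint : Integrable fun s => f s * volterraTerm q f k s :=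
      hf.mul_bdd hc.aestronglyMeasurable (.of_forall hb')
    have hz : ∀ s ≤ 0, f s * volterraTerm q f k s = 0 := fun s hs => by simp [h0 s hs]
    have key : ∀ r, 0 ≤ r → ‖volterraTerm q f (k + 1) r‖ ≤
        (∫ s in (0 : ℝ)..r, ‖f s‖) ^ (k + 1) / (k + 1).factorial := by
      intro r hr
      refine (norm_volterraOp_le hq hint hr).trans ?_
      have hpc : Continuous fun s : ℝ => (∫ t in (0 : ℝ)..s, ‖f t‖) ^ k :=
        (intervalIntegral.continuous_primitive (fun a b => hf.norm.intervalIntegrable) 0).pow k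
      calc ∫ s in (0 : ℝ)..r, ‖f s * volterraTerm q f k s‖
          ≤ ∫ s in (0 : ℝ)..r,
              (k.factorial : ℝ)⁻¹ * (‖f s‖ * (∫ t in (0 : ℝ)..s, ‖f t‖) ^ k) := by
            refine intervalIntegral.integral_mono_on hr hint.norm.intervalIntegrable
              ((hf.norm.intervalIntegrable.mul_continuousOn hpc.continuousOn).const_mul _)
              fun s hs => ?_
            rw [norm_mul]
            calc ‖f s‖ * ‖volterraTerm q f k s‖
                ≤ ‖f s‖ * ((∫ t in (0 : ℝ)..s, ‖f t‖) ^ k / k.factorial) := by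
                  gcongr
                  exact hb s hs.1
              _ = _ := by ring
        _ = _ := by
            rw [intervalIntegral.integral_const_mul, integral_mul_primitive_pow hf.norm r,
              Nat.factorial_succ]
            push_cast
            field_simp
    refine ⟨continuous_volterraOp hq hint hz, key, fun r => ?_⟩
    rcases le_total r 0 with hr | hr
    · rw [volterraTerm, volterraOp_of_nonpos hz hr, norm_zero]
      positivity
    · refine (key r hr).trans ?_
      gcongr
      · exact intervalIntegral.integral_nonneg hr fun _ _ => norm_nonneg _
      · exact norm_primitive_le hf hr

/-- The sum `∑ a_k` of the Neumann series, i.e. the solution of `a = 1 + volterraOp q (f a)`. -/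
def volterraSol (q : ℕ) (f : ℝ → ℂ) (r : ℝ) : ℂ := ∑' k, volterraTerm q f k r

variable (hq : 1 ≤ q) (hf : Integrable f) (h0 : ∀ s ≤ 0, f s = 0)

include hq hf h0

theorem continuous_volterraSol : Continuous (volterraSol q f) :=
  continuous_tsum (fun k => (volterraTerm_spec hq hf h0 k).1)
    (Real.summable_pow_div_factorial _) fun k r => (volterraTerm_spec hq hf h0 k).2.2 r

theorem hasSum_volterraSol (r : ℝ) :
    HasSum (fun k => volterraTerm q f k r) (volterraSol q f r) :=
  (Summable.of_norm_bounded (Real.summable_pow_div_factorial _)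
    fun k => (volterraTerm_spec hq hf h0 k).2.2 r).hasSum

theorem norm_volterraSol_le (r : ℝ) : ‖volterraSol q f r‖ ≤ Real.exp (∫ s, ‖f s‖) := by
  refine tsum_of_norm_bounded ?_ fun k => (volterraTerm_spec hq hf h0 k).2.2 r
  rw [Real.exp_eq_exp_ℝ]
  exact NormedSpace.expSeries_div_hasSum_exp _

theorem integrable_mul_volterraSol : Integrable fun s => f s * volterraSol q f s :=
  hf.mul_bdd (continuous_volterraSol hq hf h0).aestronglyMeasurable
    (.of_forall (norm_volterraSol_le hq hf h0))

/-- Apply the operator term by term, by dominated convergence with majorant `K |f| M^k / k!`, where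
`M = ∫ |f|`; the shifted series is the original one without its zeroth term `1`. -/
theorem volterraSol_eq (r : ℝ) :
    volterraSol q f r = 1 + volterraOp q (fun s => f s * volterraSol q f s) r := by
  have h1 : HasSum (fun k => volterraTerm q f (k + 1) r)
      (volterraOp q (fun s => f s * volterraSol q f s) r) := by
    have hk : Continuous fun s : ℝ => (q : ℝ)⁻¹ * (1 - (s / r) ^ q) := by fun_prop
    obtain ⟨K, hK⟩ := isCompact_uIcc.exists_bound_of_continuousOn (hk.continuousOn (s := Set.uIcc 0 r))
    refine intervalIntegral.hasSum_integral_of_dominated_convergence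
      (fun k s => K * (‖f s‖ * ((∫ s, ‖f s‖) ^ k / k.factorial))) (fun k => ?_) (fun k => ?_) ?_ ?_ ?_
    · exact ((Complex.continuous_ofReal.comp hk).aestronglyMeasurable.mul
        (hf.1.mul (volterraTerm_spec hq hf h0 k).1.aestronglyMeasurable)).restrict
    · refine .of_forall fun s hs => ?_
      rw [norm_mul, norm_mul, Complex.norm_real]
      have := hK s (Set.uIoc_subset_uIcc hs)
      have := (volterraTerm_spec hq hf h0 k).2.2 s
      gcongr
      exact (norm_nonneg _).trans (hK s (Set.uIoc_subset_uIcc hs))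
    · exact .of_forall fun s _ =>
        (((Real.summable_pow_div_factorial _).mul_left _).mul_left _)
    · simp only [tsum_mul_left]
      exact ((hf.norm.mul_const _).const_mul K).intervalIntegrable
    · exact .of_forall fun s _ => ((hasSum_volterraSol hq hf h0 s).mul_left _).mul_left _
  have h2 := (hasSum_nat_add_iff' 1).2 (hasSum_volterraSol hq hf h0 r)
  have h3 := h2.unique h1
  rw [← h3]
  simp [volterraTerm]

theorem volterraSol_zero : volterraSol q f 0 = 1 := by
  rw [volterraSol_eq hq hf h0, volterraOp_of_nonpos (fun s hs => by simp [h0 s hs]) le_rfl, add_zero]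

theorem hasDerivAt_volterraSol {r : ℝ} (hr : 0 < r) :
    HasDerivAt (volterraSol q f) (volterraDeriv q (fun s => f s * volterraSol q f s) r) r := by
  have h := (hasDerivAt_volterraOp hq (integrable_mul_volterraSol hq hf h0) hr).const_add 1
  exact h.congr_of_eventuallyEq (.of_forall fun t => volterraSol_eq hq hf h0 t)

end Neumann

/-! ### The radial factor as the solution of a Volterra equation -/

/-- The function `r V(r)` on `(0,1)`, extended by zero. -/
def radialPotential (V : ℝ → ℂ) : ℝ → ℂ :=
  (Set.Ioo (0 : ℝ) 1).indicator fun r => (r : ℂ) * V r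

/-- The integer `2 ℓ_m + 1`. -/
def radialIndex (d m : ℕ) : ℕ := 2 * m + d - 2

/-- The radial factor `α_m`, extended continuously to the real line. -/
def radialSol (d : ℕ) (V : ℝ → ℂ) (m : ℕ) : ℝ → ℂ :=
  volterraSol (radialIndex d m) (radialPotential V)

/-- The derivative of `α_m`. -/
def radialDeriv (d : ℕ) (V : ℝ → ℂ) (m : ℕ) : ℝ → ℂ :=
  volterraDeriv (radialIndex d m) fun s => radialPotential V s * radialSol d V m s

theorem radialIndex_pos {d : ℕ} (hd : 3 ≤ d) (m : ℕ) : 1 ≤ radialIndex d m := by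
  unfold radialIndex; omega

theorem radialIndex_cast {d : ℕ} (hd : 3 ≤ d) (m : ℕ) :
    (radialIndex d m : ℝ) = 2 * ell d m + 1 := by
  unfold radialIndex ell
  rw [Nat.cast_sub (by omega)]
  push_cast
  ring

theorem radialPotential_of_nonpos (V : ℝ → ℂ) : ∀ s ≤ 0, radialPotential V s = 0 :=
  fun _ hs => Set.indicator_of_notMem (fun h => absurd h.1 (not_lt.2 hs)) _

theorem integrable_radialPotential {V : ℝ → ℂ}
    (hV : IntegrableOn (fun r : ℝ => (r : ℂ) * V r) (Set.Ioo 0 1)) :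
    Integrable (radialPotential V) :=
  (integrable_indicator_iff measurableSet_Ioo).2 hV

theorem besselKernel_mul_rpow {q : ℕ} {l r s : ℝ} (hq : (q : ℝ) = 2 * l + 1) (hr : 0 < r)
    (hs : 0 < s) :
    besselKernel l r s * s ^ (l + 1) =
      r ^ (l + 1) * ((q : ℝ)⁻¹ * (1 - (s / r) ^ q) * s) := by
  have hsl : s ^ l ≠ 0 := (Real.rpow_pos_of_pos hs l).ne'
  have hrl : r ^ l ≠ 0 := (Real.rpow_pos_of_pos hr l).ne'
  have h1 : (s / r) ^ q = (s ^ l) ^ 2 * s / ((r ^ l) ^ 2 * r) := by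
    rw [← Real.rpow_natCast, hq, Real.div_rpow hs.le hr.le, Real.rpow_add_one hs.ne',
      Real.rpow_add_one hr.ne', mul_comm 2 l, Real.rpow_mul hs.le, Real.rpow_mul hr.le,
      Real.rpow_two, Real.rpow_two]
  rw [besselKernel, h1, hq, Real.rpow_add_one hs.ne', Real.rpow_add_one hr.ne']
  -- In the degenerate case both sides vanish because division by zero gives zero.
  by_cases h0 : 2 * l + 1 = 0
  · simp [h0]
  · field_simp

/-- The restriction `r < 1` is essential: `radialPotential` is cut off there, while `psi` sees `V`
itself. -/
theorem psi_eq {d : ℕ} (hd : 3 ≤ d) (V : ℝ → ℂ) (m k : ℕ) {r : ℝ} (hr : 0 < r) (hr1 : r < 1) :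
    psi V (ell d m) k r =
      ((r ^ (ell d m + 1) : ℝ) : ℂ) * volterraTerm (radialIndex d m) (radialPotential V) k r := by
  induction k generalizing r with
  | zero => simp [psi, volterraTerm]
  | succ k ih =>
    rw [psi, volterraTerm, volterraOp, ← intervalIntegral.integral_const_mul]
    refine intervalIntegral.integral_congr_ae (.of_forall fun s hs => ?_)
    rw [Set.uIoc_of_le hr.le] at hs
    have hs1 : s < 1 := hs.2.trans_lt hr1
    have hf : radialPotential V s = (s : ℂ) * V s := 
      Set.indicator_of_mem (show s ∈ Set.Ioo (0 : ℝ) 1 from ⟨hs.1, hs1⟩) _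
    have hk := congrArg (fun x : ℝ => (x : ℂ))
      (besselKernel_mul_rpow (radialIndex_cast hd m) hr hs.1)
    simp only [Complex.ofReal_mul] at hk
    rw [ih hs.1 hs1, hf]
    calc _ = (besselKernel (ell d m) r s : ℂ) * ((s ^ (ell d m + 1) : ℝ) : ℂ) * V s *
          volterraTerm (radialIndex d m) (radialPotential V) k s := by ring
      _ = _ := by rw [hk]; push_cast; ring

theorem alpha_eq {d : ℕ} (hd : 3 ≤ d) (V : ℝ → ℂ) (m : ℕ) {r : ℝ} (hr : 0 < r) (hr1 : r < 1) :
    alpha d V m r = radialSol d V m r := by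
  have h : ((r ^ (ell d m + 1) : ℝ) : ℂ) ≠ 0 := by
    exact_mod_cast (Real.rpow_pos_of_pos hr _).ne'
  rw [alpha, besselSol, div_eq_iff h, radialSol, volterraSol, mul_comm, ← tsum_mul_left]
  exact tsum_congr fun k => psi_eq hd V m k hr hr1

section Radial

variable {d : ℕ} (hd : 3 ≤ d) {V : ℝ → ℂ}
  (hV : IntegrableOn (fun r : ℝ => (r : ℂ) * V r) (Set.Ioo 0 1)) (m : ℕ)

include hd hV

theorem continuous_radialSol : Continuous (radialSol d V m) :=
  continuous_volterraSol (radialIndex_pos hd m) (integrable_radialPotential hV)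
    (radialPotential_of_nonpos V)

theorem radialSol_zero : radialSol d V m 0 = 1 :=
  volterraSol_zero (radialIndex_pos hd m) (integrable_radialPotential hV)
    (radialPotential_of_nonpos V)

theorem hasDerivAt_radialSol {r : ℝ} (hr : 0 < r) :
    HasDerivAt (radialSol d V m) (radialDeriv d V m r) r :=
  hasDerivAt_volterraSol (radialIndex_pos hd m) (integrable_radialPotential hV)
    (radialPotential_of_nonpos V) hr

theorem continuousOn_radialDeriv : ContinuousOn (radialDeriv d V m) (Set.Ioi 0) :=
  continuousOn_volterraDeriv _ (integrable_mul_volterraSol (radialIndex_pos hd m)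
    (integrable_radialPotential hV) (radialPotential_of_nonpos V))

theorem exists_norm_radialDeriv_le :
    ∃ C, 0 ≤ C ∧ ∀ r, 0 < r → ‖radialDeriv d V m r‖ ≤ r⁻¹ * C :=
  ⟨_, integral_nonneg fun _ => norm_nonneg _, fun _ hr =>
    norm_volterraDeriv_le _ (integrable_mul_volterraSol (radialIndex_pos hd m)
      (integrable_radialPotential hV) (radialPotential_of_nonpos V)) hr⟩

end Radial

/-! ### Polynomial functions on `ℝ^d` -/

/-- The function on `ℝ^d` given by a polynomial with complex coefficients. -/
def evalPoly {d : ℕ} (P : MvPolynomial (Fin d) ℂ) (x : Rd d) : ℂ :=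
  MvPolynomial.eval (fun i => (x i : ℂ)) P

section Poly

variable {d : ℕ}

/-- The `i`-th coordinate as a complex valued functional on `ℝ^d`. -/
def coordCLM (i : Fin d) : Rd d →L[ℝ] ℂ :=
  Complex.ofRealCLM.comp (EuclideanSpace.proj i : Rd d →L[ℝ] ℝ)

theorem coordCLM_apply (i : Fin d) (x : Rd d) : coordCLM i x = (x i : ℂ) := rfl

/-- The derivative of the polynomial function `evalPoly P`. -/
def evalPolyDeriv (P : MvPolynomial (Fin d) ℂ) (x : Rd d) : Rd d →L[ℝ] ℂ :=
  ∑ i, evalPoly (MvPolynomial.pderiv i P) x • coordCLM i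

theorem evalPoly_add (P Q : MvPolynomial (Fin d) ℂ) (x : Rd d) :
    evalPoly (P + Q) x = evalPoly P x + evalPoly Q x := map_add _ _ _

theorem evalPoly_mul (P Q : MvPolynomial (Fin d) ℂ) (x : Rd d) :
    evalPoly (P * Q) x = evalPoly P x * evalPoly Q x := map_mul _ _ _

theorem evalPoly_sum {ι : Type*} (s : Finset ι) (P : ι → MvPolynomial (Fin d) ℂ) (x : Rd d) :
    evalPoly (∑ i ∈ s, P i) x = ∑ i ∈ s, evalPoly (P i) x := map_sum _ _ _

theorem evalPoly_X (i : Fin d) (x : Rd d) :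
    evalPoly (MvPolynomial.X i) x = (x i : ℂ) := MvPolynomial.eval_X _

/-- The coordinates are real, so only coefficients are conjugated. Hermitian products of polynomials
thus become polynomials again. -/
theorem evalPoly_conj (P : MvPolynomial (Fin d) ℂ) (x : Rd d) :
    evalPoly (MvPolynomial.map (starRingEnd ℂ) P) x = conj (evalPoly P x) := by
  induction P using MvPolynomial.induction_on with
  | C a => simp [evalPoly]
  | add P Q hP hQ => rw [map_add, evalPoly_add, evalPoly_add, hP, hQ, map_add]
  | mul_X P i hP => rw [map_mul, MvPolynomial.map_X, evalPoly_mul, evalPoly_mul, hP, evalPoly_X,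
      map_mul, Complex.conj_ofReal]

theorem evalPolyDeriv_apply (P : MvPolynomial (Fin d) ℂ) (x v : Rd d) :
    evalPolyDeriv P x v = ∑ i, evalPoly (MvPolynomial.pderiv i P) x * (v i : ℂ) := by
  simp only [evalPolyDeriv, sum_apply, smul_apply, coordCLM_apply, smul_eq_mul]

theorem evalPolyDeriv_single (P : MvPolynomial (Fin d) ℂ) (x : Rd d) (i : Fin d) :
    evalPolyDeriv P x (EuclideanSpace.single i 1) = evalPoly (MvPolynomial.pderiv i P) x := by
  rw [evalPolyDeriv_apply, Finset.sum_eq_single i] <;> simp +contextual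

theorem hasFDerivAt_evalPoly (P : MvPolynomial (Fin d) ℂ) (x : Rd d) :
    HasFDerivAt (evalPoly P) (evalPolyDeriv P x) x := by
  induction P using MvPolynomial.induction_on with
  | C a =>
    have h : evalPolyDeriv (MvPolynomial.C a) x = 0 := by
      ext v
      simp [evalPolyDeriv_apply, evalPoly]
    rw [h]
    exact (hasFDerivAt_const a x).congr_of_eventuallyEq (.of_forall fun y => by simp [evalPoly])
  | add P Q hP hQ =>
    refine ((hP.add hQ).congr_fderiv ?_).congr_of_eventuallyEq
      (.of_forall fun y => evalPoly_add P Q y)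
    ext v
    simp [evalPolyDeriv_apply, evalPoly, add_mul, Finset.sum_add_distrib]
  | mul_X P i hP =>
    have h := hP.mul (coordCLM i).hasFDerivAt (x := x)
    refine (h.congr_fderiv ?_).congr_of_eventuallyEq
      (.of_forall fun y => by simp [evalPoly, coordCLM_apply])
    ext v
    have h1 : ∑ j, evalPoly P x * evalPoly (MvPolynomial.pderiv j (MvPolynomial.X i)) x * (v j : ℂ)
        = evalPoly P x * (v i : ℂ) := by
      rw [Finset.sum_eq_single i]
      · simp [evalPoly]
      · intro j _ hj
        rw [MvPolynomial.pderiv_X_of_ne hj.symm]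
        simp [evalPoly]
      · simp
    simp only [evalPolyDeriv_apply, MvPolynomial.pderiv_mul, evalPoly_add, evalPoly_mul, add_mul,
      Finset.sum_add_distrib, evalPoly_X, h1, add_apply, smul_apply, coordCLM_apply, smul_eq_mul,
      Finset.mul_sum]
    rw [add_comm]
    congr 1
    exact Finset.sum_congr rfl fun j _ => by ring

theorem continuous_evalPoly (P : MvPolynomial (Fin d) ℂ) : Continuous (evalPoly P) :=
  continuous_iff_continuousAt.2 fun x => (hasFDerivAt_evalPoly P x).continuousAt

theorem evalPoly_smul {P : MvPolynomial (Fin d) ℂ} {m : ℕ} (hP : P.IsHomogeneous m) (r : ℝ)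
    (x : Rd d) : evalPoly P (r • x) = (r : ℂ) ^ m * evalPoly P x := by
  rw [evalPoly, evalPoly, MvPolynomial.eval_eq, MvPolynomial.eval_eq, Finset.mul_sum]
  refine Finset.sum_congr rfl fun a ha => ?_
  have hdeg : ∑ i ∈ a.support, a i = m := by
    have := hP (MvPolynomial.mem_support_iff.1 ha)
    rwa [show Finsupp.weight (1 : Fin d → ℕ) a = a.degree from
      (DFunLike.congr_fun Finsupp.degree_eq_weight_one a).symm] at this
  simp only [PiLp.smul_apply, smul_eq_mul, Complex.ofReal_mul, mul_pow, Finset.prod_mul_distrib]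
  rw [Finset.prod_pow_eq_pow_sum, hdeg]
  ring

theorem mem_harmonicPolynomials {m : ℕ} {P : MvPolynomial (Fin d) ℂ} :
    P ∈ harmonicPolynomials d m ↔
      P.IsHomogeneous m ∧ ∑ i, MvPolynomial.pderiv i (MvPolynomial.pderiv i P) = 0 := by
  simp [harmonicPolynomials, Submodule.mem_inf, LinearMap.mem_ker, LinearMap.sum_apply, pow_two]

theorem map_conj_mem_harmonicPolynomials {m : ℕ} {P : MvPolynomial (Fin d) ℂ}
    (hP : P ∈ harmonicPolynomials d m) :
    MvPolynomial.map (starRingEnd ℂ) P ∈ harmonicPolynomials d m := by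
  rw [mem_harmonicPolynomials] at hP ⊢
  refine ⟨hP.1.map _, ?_⟩
  simp only [MvPolynomial.pderiv_map]
  rw [← map_sum, hP.2, map_zero]

end Poly

/-! ### Integration by parts -/

/-- Divergence theorem for the field `F e_i` on a cube around the support, where the face terms
vanish. The version with a countable exceptional set allows `F` to be only continuous at the origin,
as `α_m(|x|) P(x)` is. -/
theorem integral_fderiv_eq_zero {d : ℕ} (i : Fin d) {F : Rd d → ℂ} {F' : Rd d → Rd d →L[ℝ] ℂ}
    (hF : Continuous F) (hc : HasCompactSupport F) (hd : ∀ x, x ≠ 0 → HasFDerivAt F (F' x) x)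
    (hi : Integrable fun x => F' x (EuclideanSpace.single i 1)) :
    ∫ x, F' x (EuclideanSpace.single i 1) = 0 := by
  obtain ⟨n, rfl⟩ : ∃ n, d = n + 1 := Nat.exists_eq_succ_of_ne_zero i.pos.ne'
  obtain ⟨R, hR0, hR⟩ : ∃ R : ℝ, 0 < R ∧ tsupport F ⊆ ball 0 R :=
    hc.isBounded.subset_ball_lt 0 0
  have hmp := PiLp.volume_preserving_toLp (Fin (n + 1))
  have hemb : MeasurableEmbedding (@WithLp.toLp 2 (Fin (n + 1) → ℝ)) :=
    (MeasurableEquiv.toLp 2 (Fin (n + 1) → ℝ)).measurableEmbedding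
  let e : (Fin (n + 1) → ℝ) →L[ℝ] Rd (n + 1) :=
    (EuclideanSpace.equiv (Fin (n + 1)) ℝ).symm.toContinuousLinearMap
  have hes : e (Pi.single i 1) = EuclideanSpace.single i 1 := rfl
  rw [← hmp.integral_comp hemb]
  have hout : ∀ y : Fin (n + 1) → ℝ, (∃ j, R ≤ |y j|) → WithLp.toLp 2 y ∉ tsupport F := by
    rintro y ⟨j, hj⟩ hy
    have h1 := mem_ball_zero_iff.1 (hR hy)
    have h2 := PiLp.norm_apply_le (WithLp.toLp 2 y : Rd (n + 1)) j
    rw [Real.norm_eq_abs] at h2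
    exact absurd (hj.trans h2) (not_le.2 h1)
  set a : Fin (n + 1) → ℝ := fun _ => -R
  set b : Fin (n + 1) → ℝ := fun _ => R
  have hzero : ∀ y, y ∉ Set.Icc a b →
      F' (WithLp.toLp 2 y) (EuclideanSpace.single i 1) = 0 := by
    intro y hy
    have hy' : ∃ j, R ≤ |y j| := by
      by_contra! h
      exact hy ⟨fun j => (abs_lt.1 (h j)).1.le, fun j => (abs_lt.1 (h j)).2.le⟩
    have hns := hout y hy'
    obtain ⟨j, hj⟩ := hy'
    have hne : (WithLp.toLp 2 y : Rd (n + 1)) ≠ 0 := by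
      intro h0
      have : y j = 0 := congrArg (fun z : Rd (n + 1) => z j) h0
      rw [this, abs_zero] at hj
      linarith
    have hev : F =ᶠ[nhds (WithLp.toLp 2 y)] fun _ => 0 :=
      notMem_tsupport_iff_eventuallyEq.1 hns
    rw [(hd _ hne).unique ((hasFDerivAt_const (0 : ℂ) _).congr_of_eventuallyEq hev)]
    rfl
  rw [← setIntegral_eq_integral_of_forall_compl_eq_zero hzero]
  have hdiv := integral_divergence_of_hasFDerivAt_off_countable' a b
    (fun j => by simp only [a, b]; linarith)
    (fun j y => if j = i then F (WithLp.toLp 2 y) else 0)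
    (fun j y => if j = i then (F' (WithLp.toLp 2 y)).comp e else 0) {0}
    (Set.countable_singleton 0) (fun j => ?_) (fun y hy j => ?_) ?_
  · rw [Finset.sum_eq_single i] at hdiv
    · refine Eq.trans (setIntegral_congr_fun measurableSet_Icc fun y _ => ?_) (hdiv.trans ?_)
      · dsimp only
        rw [Finset.sum_eq_single i (fun j _ hj => by simp [hj]) (by simp)]
        simp [hes]
      · have hF0 : ∀ y : Fin (n + 1) → ℝ, (∃ j, R ≤ |y j|) → F (WithLp.toLp 2 y) = 0 :=
          fun y hy => image_eq_zero_of_notMem_tsupport (hout y hy)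
        simp only [if_true]
        rw [integral_eq_zero_of_ae, integral_eq_zero_of_ae, sub_zero]
        · exact .of_forall fun y => hF0 _ ⟨i, by simp [a, abs_of_pos hR0]⟩
        · exact .of_forall fun y => hF0 _ ⟨i, by simp [b, abs_of_pos hR0]⟩
    · intro j _ hj
      simp [hj]
    · simp
  · split_ifs
    · exact (hF.comp e.continuous).continuousOn
    · exact continuousOn_const
  · split_ifs
    · refine (hd (WithLp.toLp 2 y) fun h0 => hy.2 ?_).comp y e.hasFDerivAt
      exact (WithLp.toLp_injective 2) h0
    · exact hasFDerivAt_const _ _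
  · refine ((hmp.integrable_comp_emb hemb).2 hi).integrableOn.congr_fun (fun y _ => ?_)
      measurableSet_Icc
    dsimp only
    rw [Finset.sum_eq_single i (fun j _ hj => by simp [hj]) (by simp)]
    simp [hes]

/-! ### Polar coordinates -/

section Polar

variable {d : ℕ}

theorem integral_polar (Φ : Rd d → ℂ) (hd : d ≠ 0) :
    ∫ x, Φ x = ∫ p : Sph d × Set.Ioi (0 : ℝ), Φ (p.2.1 • (p.1 : Rd d))
      ∂(surfaceMeasure d).prod (Measure.volumeIoiPow (d - 1)) := by
  have : Nonempty (Fin d) := ⟨⟨0, Nat.pos_of_ne_zero hd⟩⟩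
  have hdim : Module.finrank ℝ (Rd d) = d := by simp
  have h := (Measure.measurePreserving_homeomorphUnitSphereProd
    (volume : Measure (Rd d))).integral_comp
    (homeomorphUnitSphereProd (Rd d)).measurableEmbedding
    fun p => Φ (p.2.1 • (p.1 : Rd d))
  rw [hdim] at h
  have h0 : ∫ x, Φ x = ∫ x : ({0}ᶜ : Set (Rd d)), Φ x.1 ∂(Measure.comap Subtype.val volume) := by
    rw [integral_subtype_comap (measurableSet_singleton (0 : Rd d)).compl,
      restrict_compl_singleton]
  rw [h0, ← h]
  refine integral_congr_ae (.of_forall fun x => ?_)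
  have hx : ‖(x : Rd d)‖ ≠ 0 := norm_ne_zero_iff.2 x.2
  simp [hx]

theorem integral_eq_zero_of_sphere {Φ : Rd d → ℂ} (hd : d ≠ 0)
    (h : ∀ r : ℝ, 0 < r → ∫ ξ : Sph d, Φ (r • (ξ : Rd d)) ∂surfaceMeasure d = 0) :
    ∫ x, Φ x = 0 := by
  rw [integral_polar Φ hd]
  by_cases hi : Integrable (fun p : Sph d × Set.Ioi (0 : ℝ) => Φ (p.2.1 • (p.1 : Rd d)))
      ((surfaceMeasure d).prod (Measure.volumeIoiPow (d - 1)))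
  · rw [integral_prod_symm _ hi]
    exact integral_eq_zero_of_ae (.of_forall fun r => h r r.2)
  -- A non-integrable function has integral `0` by convention, so no integrability hypothesis is
  -- needed.
  · exact integral_undef hi

theorem integral_radial_mul {H : Rd d → ℂ} {k : ℕ} (hd : d ≠ 0) (g : ℝ → ℂ)
    (hH : ∀ r : ℝ, 0 < r → ∀ ξ : Sph d, H (r • (ξ : Rd d)) = (r : ℂ) ^ k * H ξ) :
    ∫ x, g ‖x‖ * H x = (∫ r : Set.Ioi (0 : ℝ), (g r * (r : ℂ) ^ k)
      ∂(Measure.volumeIoiPow (d - 1))) * ∫ ξ : Sph d, H ξ ∂surfaceMeasure d := by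
  rw [integral_polar _ hd, mul_comm, ← integral_prod_mul]
  refine integral_congr_ae (.of_forall fun p => ?_)
  dsimp only
  rw [hH _ p.2.2, norm_smul, norm_eq_of_mem_sphere, mul_one, Real.norm_of_nonneg (le_of_lt p.2.2)]
  ring

end Polar

/-! ### Orthogonality of spherical harmonics -/

/-- The compactly supported radial weight `(1 - |x|²)₊ ^ j`. -/
def ballWeight (d j : ℕ) (x : Rd d) : ℝ := max 0 (1 - ‖x‖ ^ 2) ^ j

section Weight

variable {d : ℕ}

theorem continuous_ballWeight (j : ℕ) : Continuous (ballWeight d j) := by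
  unfold ballWeight
  fun_prop

theorem ballWeight_nonneg (j : ℕ) (x : Rd d) : 0 ≤ ballWeight d j x :=
  pow_nonneg (le_max_left _ _) _

theorem hasCompactSupport_ballWeight {j : ℕ} (hj : j ≠ 0) :
    HasCompactSupport (ballWeight d j) := by
  refine HasCompactSupport.intro (isCompact_closedBall 0 1) fun x hx => ?_
  have h1 : 1 < ‖x‖ := by simpa using hx
  rw [ballWeight, max_eq_left (by nlinarith), zero_pow hj]

theorem integrable_ballWeight_mul {j : ℕ} (hj : j ≠ 0) {H : Rd d → ℂ} (hH : Continuous H) :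
    Integrable fun x => (ballWeight d j x : ℂ) * H x := by
  refine Continuous.integrable_of_hasCompactSupport
    ((Complex.continuous_ofReal.comp (continuous_ballWeight j)).mul hH) ?_
  exact ((hasCompactSupport_ballWeight hj).comp_left Complex.ofReal_zero).mul_right

/-- Sphere integrals of homogeneous functions are traded for weighted integrals over space, where
integration by parts is elementary. One constant `c` serves every `H` of degree `k`. -/
theorem exists_integral_ballWeight_mul (hd : d ≠ 0) {j : ℕ} (hj : j ≠ 0) (k : ℕ) :
    ∃ c : ℂ, c ≠ 0 ∧ ∀ H : Rd d → ℂ,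
      (∀ r : ℝ, 0 < r → ∀ ξ : Sph d, H (r • (ξ : Rd d)) = (r : ℂ) ^ k * H ξ) →
      ∫ x, (ballWeight d j x : ℂ) * H x = c * ∫ ξ : Sph d, H ξ ∂surfaceMeasure d := by
  refine ⟨_, ?_, fun H hH =>
    integral_radial_mul hd (fun r => ((max 0 (1 - r ^ 2) ^ j : ℝ) : ℂ)) hH⟩
  -- Test with `H = |x|^k`: if `c` were zero, the integral of a nonzero nonnegative continuous
  -- function would vanish.
  intro h0
  have h := integral_radial_mul (H := fun x : Rd d => ((‖x‖ ^ k : ℝ) : ℂ)) (k := k) hd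
    (fun r => ((max 0 (1 - r ^ 2) ^ j : ℝ) : ℂ)) fun r hr ξ => by
      rw [norm_smul, Real.norm_of_nonneg hr.le, mul_pow]
      push_cast
      ring
  rw [h0, zero_mul] at h
  have : Nonempty (Fin d) := ⟨⟨0, Nat.pos_of_ne_zero hd⟩⟩
  obtain ⟨x, hx⟩ : ∃ x : Rd d, ‖x‖ = 1 / 2 := exists_norm_eq _ (by norm_num)
  have hpos : 0 < ∫ x : Rd d, ballWeight d j x * ‖x‖ ^ k := by
    refine Continuous.integral_pos_of_hasCompactSupport_nonneg_nonzero (x := x)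
      ((continuous_ballWeight j).mul (by fun_prop)) (hasCompactSupport_ballWeight hj).mul_right
      (fun x => mul_nonneg (ballWeight_nonneg j x) (by positivity)) ?_
    rw [ballWeight, hx]
    have : max 0 (1 - (1 / 2 : ℝ) ^ 2) = 3 / 4 := by norm_num
    rw [this]
    positivity
  refine hpos.ne' ?_
  rw [← Complex.ofReal_eq_zero, ← h, ← integral_complex_ofReal]
  simp [ballWeight]

theorem hasDerivAt_max_zero_sq (t : ℝ) :
    HasDerivAt (fun t : ℝ => max 0 t ^ 2) (2 * max 0 t) t := by
  rcases lt_trichotomy t 0 with ht | rfl | ht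
  · rw [max_eq_left ht.le, mul_zero]
    refine (hasDerivAt_const t (0 : ℝ)).congr_of_eventuallyEq ?_
    filter_upwards [gt_mem_nhds ht] with s hs
    rw [max_eq_left hs.le]
    norm_num
  · rw [hasDerivAt_iff_isLittleO]
    simp only [max_self, mul_zero, sub_zero, smul_zero, ne_eq, OfNat.ofNat_ne_zero,
      not_false_eq_true, zero_pow]
    refine Asymptotics.IsBigO.trans_isLittleO (g := fun t : ℝ => t ^ 2) ?_ ?_
    · refine Asymptotics.IsBigO.of_norm_le fun t => ?_
      rw [norm_pow, Real.norm_eq_abs, ← sq_abs t]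
      refine pow_le_pow_left₀ (abs_nonneg _) ?_ 2
      rw [abs_of_nonneg (le_max_left 0 t)]
      exact max_le (abs_nonneg t) (le_abs_self t)
    · simpa using Asymptotics.isLittleO_pow_pow (𝕜 := ℝ) (m := 1) (n := 2) (by norm_num)
  · rw [max_eq_right ht.le]
    have := hasDerivAt_pow 2 t
    refine HasDerivAt.congr_of_eventuallyEq (by simpa using this) ?_
    filter_upwards [lt_mem_nhds ht] with s hs
    rw [max_eq_right hs.le]

theorem hasFDerivAt_ballWeight (x : Rd d) :
    HasFDerivAt (ballWeight d 2) ((-4 * ballWeight d 1 x) • innerSL ℝ x) x := by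
  have h := (hasDerivAt_max_zero_sq (1 - ‖x‖ ^ 2)).comp_hasFDerivAt x
    ((hasStrictFDerivAt_norm_sq x).hasFDerivAt.const_sub 1)
  refine h.congr_fderiv ?_
  ext v
  simp [ballWeight]
  ring

theorem integral_ballWeight_pderiv (i : Fin d) (G : MvPolynomial (Fin d) ℂ) :
    ∫ x, (ballWeight d 2 x : ℂ) * evalPoly (MvPolynomial.pderiv i G) x =
      4 * ∫ x, (ballWeight d 1 x : ℂ) * evalPoly (MvPolynomial.X i * G) x := by
  have hi1 := integrable_ballWeight_mul (d := d) two_ne_zero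
    (continuous_evalPoly (MvPolynomial.pderiv i G))
  have hi2 := integrable_ballWeight_mul (d := d) one_ne_zero
    (continuous_evalPoly (MvPolynomial.X i * G))
  have h := integral_fderiv_eq_zero i (F := fun x => (ballWeight d 2 x : ℂ) * evalPoly G x)
    (F' := fun x => (ballWeight d 2 x : ℂ) • evalPolyDeriv G x + evalPoly G x •
      (Complex.ofRealCLM.comp ((-4 * ballWeight d 1 x) • innerSL ℝ x)))
    ((Complex.continuous_ofReal.comp (continuous_ballWeight 2)).mul (continuous_evalPoly G))
    ((hasCompactSupport_ballWeight two_ne_zero).comp_left Complex.ofReal_zero).mul_right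
    (fun x _ => (Complex.ofRealCLM.hasFDerivAt.comp x (hasFDerivAt_ballWeight x)).mul
      (hasFDerivAt_evalPoly G x))
  have he : (fun x => ((ballWeight d 2 x : ℂ) • evalPolyDeriv G x + evalPoly G x •
      (Complex.ofRealCLM.comp ((-4 * ballWeight d 1 x) • innerSL ℝ x)))
        (EuclideanSpace.single i 1)) = fun x =>
      (ballWeight d 2 x : ℂ) * evalPoly (MvPolynomial.pderiv i G) x -
        4 * ((ballWeight d 1 x : ℂ) * evalPoly (MvPolynomial.X i * G) x) := by
    ext x
    have hin : inner ℝ x (EuclideanSpace.single i (1 : ℝ)) = x i := by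
      simp [EuclideanSpace.inner_single_right]
    simp only [add_apply, smul_apply, evalPolyDeriv_single, ContinuousLinearMap.comp_apply,
      innerSL_apply_apply, hin, Complex.ofRealCLM_apply, smul_eq_mul, evalPoly_mul, evalPoly_X]
    push_cast
    ring
  rw [he] at h
  have h' := h (hi1.sub (hi2.const_mul 4))
  rw [integral_sub hi1 (hi2.const_mul 4), integral_const_mul, sub_eq_zero] at h'
  exact h'

/-- Since `∇(1 - |x|²)₊² = -4 (1 - |x|²)₊ x`, this plays the role of the divergence theorem on the
ball: `x · G` is the normal flux. The square makes the weight differentiable across the unit sphere.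
-/
theorem integral_ballWeight_divergence (G : Fin d → MvPolynomial (Fin d) ℂ) :
    ∫ x, (ballWeight d 2 x : ℂ) * evalPoly (∑ i, MvPolynomial.pderiv i (G i)) x =
      4 * ∫ x, (ballWeight d 1 x : ℂ) * evalPoly (∑ i, MvPolynomial.X i * G i) x := by
  simp only [evalPoly_sum, Finset.mul_sum]
  rw [integral_finsetSum _ fun i _ => integrable_ballWeight_mul two_ne_zero (continuous_evalPoly _),
    integral_finsetSum _ fun i _ => integrable_ballWeight_mul one_ne_zero (continuous_evalPoly _),
    Finset.mul_sum]
  exact Finset.sum_congr rfl fun i _ => integral_ballWeight_pderiv i (G i)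

end Weight

section Sphere

variable {d m n : ℕ} {P Q : MvPolynomial (Fin d) ℂ}

open MvPolynomial in
/-- Spherical harmonics of different degrees are orthogonal. -/
theorem integral_sphere_mul_eq_zero (hd : d ≠ 0) (hP : P ∈ harmonicPolynomials d m)
    (hQ : Q ∈ harmonicPolynomials d n) (hmn : m ≠ n) :
    ∫ ξ : Sph d, evalPoly (P * Q) ξ ∂surfaceMeasure d = 0 := by
  rw [mem_harmonicPolynomials] at hP hQ
  obtain ⟨c, hc, h⟩ := exists_integral_ballWeight_mul hd one_ne_zero (m + n)
  -- Green's field `P∇Q - Q∇P` is divergence free by harmonicity, and its flux density is `(n - m) P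
  -- Q` by Euler's identity.
  have hdiv := integral_ballWeight_divergence fun i => P * pderiv i Q - Q * pderiv i P
  have e1 : ∑ i, pderiv i (P * pderiv i Q - Q * pderiv i P) = 0 := by
    calc _ = P * ∑ i, pderiv i (pderiv i Q) - Q * ∑ i, pderiv i (pderiv i P) := by
          rw [Finset.mul_sum, Finset.mul_sum, ← Finset.sum_sub_distrib]
          refine Finset.sum_congr rfl fun i _ => ?_
          rw [map_sub, pderiv_mul, pderiv_mul]
          ring
      _ = 0 := by rw [hP.2, hQ.2, mul_zero, mul_zero, sub_zero]
  have e2 : ∑ i, X i * (P * pderiv i Q - Q * pderiv i P) = C ((n : ℂ) - m) * (P * Q) := by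
    calc _ = P * ∑ i, X i * pderiv i Q - Q * ∑ i, X i * pderiv i P := by
          rw [Finset.mul_sum, Finset.mul_sum, ← Finset.sum_sub_distrib]
          exact Finset.sum_congr rfl fun i _ => by ring
      _ = _ := by
          rw [hP.1.sum_X_mul_pderiv, hQ.1.sum_X_mul_pderiv, map_sub, map_natCast, map_natCast,
            nsmul_eq_mul, nsmul_eq_mul]
          ring
  have e3 : ∫ x, (ballWeight d 1 x : ℂ) * evalPoly (C ((n : ℂ) - m) * (P * Q)) x =
      ((n : ℂ) - m) * ∫ x, (ballWeight d 1 x : ℂ) * evalPoly (P * Q) x := by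
    rw [← integral_const_mul]
    refine integral_congr_ae (.of_forall fun x => ?_)
    simp only [evalPoly_mul]
    rw [show evalPoly (C ((n : ℂ) - m)) x = (n : ℂ) - m from eval_C _]
    ring
  have e4 : ∫ x : Rd d, (ballWeight d 2 x : ℂ) * evalPoly 0 x = 0 := by
    simp [evalPoly]
  have hnm : (n : ℂ) - m ≠ 0 := sub_ne_zero.2 (by exact_mod_cast hmn.symm)
  rw [e1, e2, e3, e4, h _ fun r _ ξ => evalPoly_smul (hP.1.mul hQ.1) r ξ] at hdiv
  simpa [hnm, hc] using hdiv.symm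

open MvPolynomial in
/-- If two spherical harmonics are orthogonal, then so are the gradients of the corresponding
harmonic polynomials. -/
theorem integral_sphere_grad_eq_zero (hd : d ≠ 0) (hP : P.IsHomogeneous m)
    (hQ : Q ∈ harmonicPolynomials d n)
    (h0 : ∫ ξ : Sph d, evalPoly (P * Q) ξ ∂surfaceMeasure d = 0) :
    ∫ ξ : Sph d, evalPoly (∑ i, pderiv i P * pderiv i Q) ξ ∂surfaceMeasure d = 0 := by
  rw [mem_harmonicPolynomials] at hQ
  obtain ⟨c₁, -, h₁⟩ := exists_integral_ballWeight_mul hd one_ne_zero (m + n)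
  -- Truncated subtraction is harmless: in degree `0` the derivatives vanish, and zero is
  -- homogeneous of every degree.
  obtain ⟨c₂, hc₂, h₂⟩ := exists_integral_ballWeight_mul hd two_ne_zero (m - 1 + (n - 1))
  -- The field `P∇Q` has divergence `∇P · ∇Q`, as `Q` is harmonic, and flux density `n P Q`.
  have hdiv := integral_ballWeight_divergence fun i => P * pderiv i Q
  have e1 : ∑ i, pderiv i (P * pderiv i Q) = ∑ i, pderiv i P * pderiv i Q := by
    simp only [pderiv_mul, Finset.sum_add_distrib, ← Finset.mul_sum, hQ.2, mul_zero, add_zero]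
  have e2 : ∑ i, X i * (P * pderiv i Q) = n • (P * Q) := by
    rw [← mul_smul_comm, ← hQ.1.sum_X_mul_pderiv, Finset.mul_sum]
    exact Finset.sum_congr rfl fun i _ => by ring
  have e3 : ∫ x, (ballWeight d 1 x : ℂ) * evalPoly (n • (P * Q)) x =
      n * ∫ x, (ballWeight d 1 x : ℂ) * evalPoly (P * Q) x := by
    rw [← integral_const_mul]
    refine integral_congr_ae (.of_forall fun x => ?_)
    simp [evalPoly]
    ring
  have hhom : (∑ i, pderiv i P * pderiv i Q).IsHomogeneous (m - 1 + (n - 1)) :=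
    IsHomogeneous.sum _ _ _ fun i _ => hP.pderiv.mul hQ.1.pderiv
  rw [e1, e2, e3, h₁ _ fun r _ ξ => evalPoly_smul (hP.mul hQ.1) r ξ, h0,
    h₂ _ fun r _ ξ => evalPoly_smul hhom r ξ] at hdiv
  simpa [hc₂] using hdiv

end Sphere

/-! ### Formal spherical polynomials are Sobolev functions -/

/-- The function `x ↦ α_m(|x|) P(x)` on `ℝ^d`. -/
def formalFun (d : ℕ) (V : ℝ → ℂ) (m : ℕ) (P : MvPolynomial (Fin d) ℂ) (x : Rd d) : ℂ :=
  radialSol d V m ‖x‖ * evalPoly P x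

/-- The `i`-th partial derivative of `formalFun d V m P` away from the origin. -/
def formalGrad (d : ℕ) (V : ℝ → ℂ) (m : ℕ) (P : MvPolynomial (Fin d) ℂ) (i : Fin d)
    (x : Rd d) : ℂ :=
  radialDeriv d V m ‖x‖ * ((‖x‖⁻¹ * x i : ℝ) : ℂ) * evalPoly P x +
    radialSol d V m ‖x‖ * evalPoly (MvPolynomial.pderiv i P) x

instance (d : ℕ) : IsFiniteMeasure (ballMeasure d) :=
  ⟨by rw [Measure.restrict_apply_univ]; exact measure_ball_lt_top⟩

theorem ae_ballMeasure_mem (d : ℕ) : ∀ᵐ x ∂ballMeasure d, x ∈ ball (0 : Rd d) 1 :=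
  ae_restrict_mem measurableSet_ball

theorem ae_ballMeasure_ne_zero {d : ℕ} (hd : 3 ≤ d) : ∀ᵐ x ∂ballMeasure d, x ≠ 0 := by
  have : Nonempty (Fin d) := ⟨⟨0, by omega⟩⟩
  exact ae_restrict_of_ae (Measure.ae_ne volume 0)

/-- In polar coordinates the square becomes `r^(-2) r^(d-1) = r^(d-3)`, integrable at `0` because `d
≥ 3`. -/
theorem memLp_inv_norm {d : ℕ} (hd : 3 ≤ d) :
    MemLp (fun x : Rd d => ‖x‖⁻¹) 2 (ballMeasure d) := by
  have : Nonempty (Fin d) := ⟨⟨0, by omega⟩⟩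
  rw [memLp_two_iff_integrable_sq_norm (by fun_prop)]
  have h := (integrableOn_fun_norm_addHaar (volume : Measure (Rd d)) (r := 1)
    (f := fun r : ℝ => ‖r⁻¹‖ ^ 2)).2 ?_
  · exact h
  · refine IntegrableOn.congr_fun (f := fun r : ℝ => r ^ (d - 3)) ?_ (fun r hr => ?_)
      measurableSet_Ioo
    · exact ((continuous_pow (d - 3)).continuousOn.integrableOn_Icc (a := 0) (b := 1)).mono_set
        Set.Ioo_subset_Icc_self
    · have hr0 : r ≠ 0 := hr.1.ne'
      obtain ⟨e, rfl⟩ : ∃ e, d = e + 3 := ⟨d - 3, by omega⟩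
      simp only [finrank_euclideanSpace, Fintype.card_fin, Real.norm_eq_abs, sq_abs, smul_eq_mul,
        Nat.add_sub_cancel, show e + 3 - 1 = e + 2 by omega]
      field_simp
      ring

theorem hasFDerivAt_norm {d : ℕ} {x : Rd d} (hx : x ≠ 0) :
    HasFDerivAt (fun y : Rd d => ‖y‖) (‖x‖⁻¹ • innerSL ℝ x) x := by
  have hx' : ‖x‖ ≠ 0 := norm_ne_zero_iff.2 hx
  have h := (Real.hasDerivAt_sqrt (pow_ne_zero 2 hx')).comp_hasFDerivAt x
    (hasStrictFDerivAt_norm_sq x).hasFDerivAt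
  refine (h.congr_fderiv ?_).congr_of_eventuallyEq
    (.of_forall fun y => (Real.sqrt_sq (norm_nonneg y)).symm)
  ext v
  simp only [smul_apply, Real.sqrt_sq (norm_nonneg x), smul_eq_mul, nsmul_eq_mul]
  push_cast
  field_simp

theorem setIntegral_ball_eq {d : ℕ} {f : Rd d → ℂ} (hf : ∀ x ∉ ball (0 : Rd d) 1, f x = 0) :
    ∫ x, f x ∂ballMeasure d = ∫ x, f x :=
  setIntegral_eq_integral_of_forall_compl_eq_zero hf

section Formal

variable {d : ℕ} (hd : 3 ≤ d) {V : ℝ → ℂ}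
  (hV : IntegrableOn (fun r : ℝ => (r : ℂ) * V r) (Set.Ioo 0 1)) (m : ℕ)
  (P : MvPolynomial (Fin d) ℂ)

include hd

theorem formalPolynomial_restrictSphere {P : MvPolynomial (Fin d) ℂ} (V : ℝ → ℂ) {m : ℕ}
    (hP : P.IsHomogeneous m) {x : Rd d} (hx : x ∈ ball (0 : Rd d) 1) (hx0 : x ≠ 0) :
    formalPolynomial d V m (restrictSphere d P) x = formalFun d V m P x := by
  have hn : 0 < ‖x‖ := norm_pos_iff.2 hx0
  have h : restrictSphere d P (direction x hx0) = evalPoly P (‖x‖⁻¹ • x) := rfl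
  rw [formalPolynomial, dif_neg hx0, formalFun, alpha_eq hd V m hn (mem_ball_zero_iff.1 hx), h,
    evalPoly_smul hP]
  have h1 : (‖x‖ : ℂ) ^ m * ((‖x‖⁻¹ : ℝ) : ℂ) ^ m = 1 := by
    rw [← mul_pow]
    norm_cast
    rw [mul_inv_cancel₀ hn.ne', one_pow]
  linear_combination (radialSol d V m ‖x‖ * evalPoly P x) * h1

theorem formalPolynomial_ae_eq {P : MvPolynomial (Fin d) ℂ} (V : ℝ → ℂ) {m : ℕ}
    (hP : P.IsHomogeneous m) :
    formalPolynomial d V m (restrictSphere d P) =ᵐ[ballMeasure d] formalFun d V m P := by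
  filter_upwards [ae_ballMeasure_mem d, ae_ballMeasure_ne_zero hd] with x hx hx0
  exact formalPolynomial_restrictSphere hd V hP hx hx0

include hV

theorem continuous_formalFun : Continuous (formalFun d V m P) :=
  ((continuous_radialSol hd hV m).comp continuous_norm).mul (continuous_evalPoly P)

theorem hasFDerivAt_formalFun {x : Rd d} (hx : x ≠ 0) :
    ∃ D : Rd d →L[ℝ] ℂ, HasFDerivAt (formalFun d V m P) D x ∧
      ∀ i, D (EuclideanSpace.single i 1) = formalGrad d V m P i x := by
  have h := ((hasDerivAt_radialSol hd hV m (norm_pos_iff.2 hx)).hasFDerivAt.comp x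
    (hasFDerivAt_norm hx)).mul (hasFDerivAt_evalPoly P x)
  refine ⟨_, h, fun i => ?_⟩
  have hin : inner ℝ x (EuclideanSpace.single i (1 : ℝ)) = x i := by
    simp [EuclideanSpace.inner_single_right]
  simp only [add_apply, smul_apply, evalPolyDeriv_single, ContinuousLinearMap.comp_apply,
    ContinuousLinearMap.toSpanSingleton_apply, innerSL_apply_apply, hin, smul_eq_mul,
    Complex.real_smul, formalGrad, Function.comp_apply]
  push_cast
  ring

theorem memLp_formalFun : MemLp (formalFun d V m P) 2 (ballMeasure d) := by
  have hc := continuous_formalFun hd hV m P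
  obtain ⟨C, hC⟩ := (isCompact_closedBall (0 : Rd d) 1).exists_bound_of_continuousOn
    hc.continuousOn
  refine MemLp.of_bound hc.aestronglyMeasurable C ?_
  filter_upwards [ae_ballMeasure_mem d] with x hx
  exact hC x (ball_subset_closedBall hx)

theorem memLp_formalGrad (i : Fin d) : MemLp (formalGrad d V m P i) 2 (ballMeasure d) := by
  obtain ⟨K, hK'⟩ := (isCompact_closedBall (0 : Rd d) 1).exists_bound_of_continuousOn
    (continuous_evalPoly P).continuousOn
  have hK0 : 0 ≤ K := (norm_nonneg _).trans (hK' 0 (by simp))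
  have hK : ∀ x ∈ ball (0 : Rd d) 1, ‖evalPoly P x‖ ≤ K :=
    fun x hx => hK' x (ball_subset_closedBall hx)
  have hmeas : AEStronglyMeasurable (fun x : Rd d => radialDeriv d V m ‖x‖) (ballMeasure d) := by
    have h1 : ContinuousOn (fun x : Rd d => radialDeriv d V m ‖x‖) {0}ᶜ :=
      (continuousOn_radialDeriv hd hV m).comp continuous_norm.continuousOn
        fun x hx => norm_pos_iff.2 hx
    have h2 := h1.aestronglyMeasurable (μ := ballMeasure d) (measurableSet_singleton 0).compl
    have h3 : (ballMeasure d).restrict {0}ᶜ = ballMeasure d :=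
      Measure.restrict_eq_self_of_ae_mem (ae_ballMeasure_ne_zero hd)
    rwa [h3] at h2
  obtain ⟨C, hC0, hC⟩ := exists_norm_radialDeriv_le hd hV m
  refine MemLp.add (f := fun x : Rd d =>
    radialDeriv d V m ‖x‖ * ((‖x‖⁻¹ * x i : ℝ) : ℂ) * evalPoly P x) ?_
    (memLp_formalFun hd hV m (MvPolynomial.pderiv i P))
  refine (memLp_inv_norm hd).of_le_mul (c := C * K) ?_ ?_
  · refine (hmeas.mul ?_).mul (continuous_evalPoly P).aestronglyMeasurable
    exact (Complex.measurable_ofReal.comp (by fun_prop)).aestronglyMeasurable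
  · filter_upwards [ae_ballMeasure_mem d, ae_ballMeasure_ne_zero hd] with x hx hx0
    have hn := norm_pos_iff.2 hx0
    have h1 : ‖((‖x‖⁻¹ * x i : ℝ) : ℂ)‖ ≤ 1 := by
      rw [Complex.norm_real, norm_mul, norm_inv, norm_norm, inv_mul_le_one₀ hn]
      exact PiLp.norm_apply_le x i
    rw [norm_mul, norm_mul, norm_inv, norm_norm]
    calc _ ≤ (‖x‖⁻¹ * C) * 1 * K := by
          gcongr
          · exact hC _ hn
          · exact hK x hx
      _ = _ := by ring

/-- Apply `integral_fderiv_eq_zero` to `φ U`, which is continuous with compact support and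
differentiable off the origin. -/
theorem isWeakPartial_formalFun (i : Fin d) :
    IsWeakPartial d i (formalFun d V m P) (formalGrad d V m P i) := by
  intro φ hφ hφc hφs
  have hout : ∀ x ∉ ball (0 : Rd d) 1, x ∉ tsupport φ := fun x hx h => hx (hφs h)
  have hz1 : ∀ x ∉ ball (0 : Rd d) 1,
      fderiv ℝ φ x (EuclideanSpace.single i 1) • formalFun d V m P x = 0 := by
    intro x hx
    have : fderiv ℝ φ x = 0 := by
      by_contra h
      exact hout x hx (support_fderiv_subset ℝ h)
    rw [this]
    simp
  have hz2 : ∀ x ∉ ball (0 : Rd d) 1, φ x • formalGrad d V m P i x = 0 := fun x hx => by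
    rw [image_eq_zero_of_notMem_tsupport (hout x hx), zero_smul]
  have hcu := continuous_formalFun hd hV m P
  have hdc : Continuous fun x => fderiv ℝ φ x (EuclideanSpace.single i 1) :=
    (hφ.continuous_fderiv (by simp)).clm_apply continuous_const
  have hi1 : Integrable fun x =>
      fderiv ℝ φ x (EuclideanSpace.single i 1) • formalFun d V m P x :=
    (hdc.smul hcu).integrable_of_hasCompactSupport (hφc.fderiv_apply ℝ _).smul_right
  have hi2 : Integrable fun x => φ x • formalGrad d V m P i x := by
    obtain ⟨C, hC⟩ := hφc.exists_bound_of_continuous hφ.continuous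
    have h := ((memLp_formalGrad hd hV m P i).integrable (by norm_num)).bdd_smul C
      (hφ.continuous.aestronglyMeasurable (μ := ballMeasure d)) (.of_forall hC)
    exact (integrableOn_iff_integrable_of_support_subset
      (Function.support_subset_iff'.2 hz2)).1 h
  choose! D hD hDi using fun (x : Rd d) (hx : x ≠ 0) => hasFDerivAt_formalFun hd hV m P hx
  have hae : (fun x => (φ x • D x + (fderiv ℝ φ x).smulRight (formalFun d V m P x))
      (EuclideanSpace.single i 1)) =ᵐ[volume] fun x =>
      φ x • formalGrad d V m P i x +
        fderiv ℝ φ x (EuclideanSpace.single i 1) • formalFun d V m P x := by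
    have : Nonempty (Fin d) := ⟨i⟩
    filter_upwards [Measure.ae_ne volume (0 : Rd d)] with x hx
    simp [hDi x hx]
  have h := integral_fderiv_eq_zero i (F := fun x => φ x • formalFun d V m P x)
    (F' := fun x => φ x • D x + (fderiv ℝ φ x).smulRight (formalFun d V m P x))
    (hφ.continuous.smul hcu) hφc.smul_right
    (fun x hx => ((hφ.differentiable (by simp)) x).hasFDerivAt.smul (hD x hx))
    ((hi2.add hi1).congr hae.symm)
  rw [integral_congr_ae hae, integral_add hi2 hi1] at h
  rw [setIntegral_ball_eq hz1, setIntegral_ball_eq hz2]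
  exact eq_neg_of_add_eq_zero_right h

end Formal

/-! ### The Sobolev space -/

section Sobolev

variable {d : ℕ}

theorem IsWeakPartial.congr {i : Fin d} {u u' g g' : Rd d → ℂ} (h : IsWeakPartial d i u g)
    (hu : u =ᵐ[ballMeasure d] u') (hg : g =ᵐ[ballMeasure d] g') : IsWeakPartial d i u' g' := by
  intro φ hφ hφc hφs
  rw [← integral_congr_ae (hu.mono fun x hx => congrArg
      (fun z => fderiv ℝ φ x (EuclideanSpace.single i 1) • z) hx), h φ hφ hφc hφs,
    integral_congr_ae (hg.mono fun x hx => congrArg (fun z => φ x • z) hx)]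

theorem IsWeakPartial.unique {i : Fin d} {u g g' : Rd d → ℂ} (h : IsWeakPartial d i u g)
    (h' : IsWeakPartial d i u g') (hg : Integrable g (ballMeasure d))
    (hg' : Integrable g' (ballMeasure d)) : g =ᵐ[ballMeasure d] g' := by
  have key := IsOpen.ae_eq_zero_of_integral_contDiff_smul_eq_zero (μ := ballMeasure d)
    (f := fun x => g x - g' x) (isOpen_ball (x := (0 : Rd d)) (ε := 1))
    ((hg.sub hg').locallyIntegrable.locallyIntegrableOn _) ?_
  · filter_upwards [key, ae_ballMeasure_mem d] with x hx hxb
    exact sub_eq_zero.1 (hx hxb)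
  · intro φ hφ hφc hφs
    obtain ⟨C, hC⟩ := hφc.exists_bound_of_continuous hφ.continuous
    have hm := hφ.continuous.aestronglyMeasurable (μ := ballMeasure d)
    simp only [smul_sub]
    refine (integral_sub (hg.bdd_smul C hm (.of_forall hC))
      (hg'.bdd_smul C hm (.of_forall hC))).trans ?_
    simp only [Pi.smul_apply']
    rw [sub_eq_zero, ← neg_inj, ← h φ hφ hφc hφs, h' φ hφ hφc hφs]

/-- The element of `W^{1,2}` given by a square integrable function and its weak gradient. -/
def W12.mk (u : Rd d → ℂ) (g : Fin d → Rd d → ℂ) (hu : MemLp u 2 (ballMeasure d))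
    (hg : ∀ i, MemLp (g i) 2 (ballMeasure d)) (h : ∀ i, IsWeakPartial d i u (g i)) : W12 d :=
  show sobolevGraph d from ⟨WithLp.toLp 2 (hu.toLp u, WithLp.toLp 2 fun i => (hg i).toLp (g i)),
    fun i => (h i).congr hu.coeFn_toLp.symm (hg i).coeFn_toLp.symm⟩

theorem W12.mk_represents (u : Rd d → ℂ) (g : Fin d → Rd d → ℂ)
    (hu : MemLp u 2 (ballMeasure d)) (hg : ∀ i, MemLp (g i) 2 (ballMeasure d))
    (h : ∀ i, IsWeakPartial d i u (g i)) : (W12.mk u g hu hg h).Represents u :=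
  hu.coeFn_toLp

theorem W12.integrable_grad (f : W12 d) (i : Fin d) :
    Integrable (fun x => f.grad i x) (ballMeasure d) :=
  (Lp.memLp (f.grad i)).integrable (by norm_num)

/-- Elements are pairs `(u, ∇u)`, but weak derivatives are unique by the fundamental lemma of the
calculus of variations. -/
theorem W12.ext_fn {f g : W12 d} (h : f.fn = g.fn) : f = g := by
  have hgrad : ∀ i, f.grad i = g.grad i := fun i => by
    refine Lp.ext ((f.isWeakPartial i).unique ?_ (f.integrable_grad i) (g.integrable_grad i))
    rw [h]
    exact g.isWeakPartial i
  exact Subtype.ext (WithLp.ofLp_injective 2 (Prod.ext h (PiLp.ext hgrad)))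

theorem W12.eq_of_represents {f g : W12 d} {u : Rd d → ℂ} (hf : f.Represents u)
    (hg : g.Represents u) : f = g :=
  W12.ext_fn (Lp.ext (hf.trans hg.symm))

end Sobolev

/-! ### The inner product of formal spherical polynomials -/

section Orthogonality

variable {d : ℕ}

theorem evalPoly_conj_pderiv (P : MvPolynomial (Fin d) ℂ) (i : Fin d) (x : Rd d) :
    conj (evalPoly (MvPolynomial.pderiv i P) x) =
      evalPoly (MvPolynomial.pderiv i (MvPolynomial.map (starRingEnd ℂ) P)) x := by
  rw [MvPolynomial.pderiv_map, evalPoly_conj]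

theorem sum_coord_mul_evalPoly_pderiv {m : ℕ} {P : MvPolynomial (Fin d) ℂ}
    (hP : P.IsHomogeneous m) (x : Rd d) :
    ∑ i, (x i : ℂ) * evalPoly (MvPolynomial.pderiv i P) x = m * evalPoly P x := by
  have h := congrArg (fun Q => evalPoly Q x) hP.sum_X_mul_pderiv
  simp only [evalPoly_sum, evalPoly_mul, evalPoly_X] at h
  rw [h]
  simp [evalPoly]

theorem sum_coord_sq (ξ : Sph d) : ∑ i, ((ξ : Rd d) i : ℂ) * ((ξ : Rd d) i : ℂ) = 1 := by
  have h := EuclideanSpace.real_norm_sq_eq (ξ : Rd d)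
  rw [norm_eq_of_mem_sphere, one_pow] at h
  have h' := congrArg (fun t : ℝ => (t : ℂ)) h
  push_cast at h'
  rw [h']
  exact Finset.sum_congr rfl fun i _ => (sq _).symm

theorem formalFun_smul_sphere (V : ℝ → ℂ) {m : ℕ} {P : MvPolynomial (Fin d) ℂ}
    (hP : P.IsHomogeneous m) {r : ℝ} (hr : 0 < r) (ξ : Sph d) :
    formalFun d V m P (r • (ξ : Rd d)) = radialSol d V m r * r ^ m * evalPoly P ξ := by
  rw [formalFun, evalPoly_smul hP, norm_smul, norm_eq_of_mem_sphere, mul_one,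
    Real.norm_of_nonneg hr.le, mul_assoc]

theorem formalGrad_smul_sphere (V : ℝ → ℂ) {m : ℕ} {P : MvPolynomial (Fin d) ℂ}
    (hP : P.IsHomogeneous m) (i : Fin d) {r : ℝ} (hr : 0 < r) (ξ : Sph d) :
    formalGrad d V m P i (r • (ξ : Rd d)) =
      radialDeriv d V m r * r ^ m * ((ξ : Rd d) i * evalPoly P ξ) +
        radialSol d V m r * r ^ (m - 1) * evalPoly (MvPolynomial.pderiv i P) ξ := by
  have h : r⁻¹ * (r • (ξ : Rd d)) i = (ξ : Rd d) i := by
    rw [PiLp.smul_apply, smul_eq_mul, inv_mul_cancel_left₀ hr.ne']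
  rw [formalGrad, evalPoly_smul hP, evalPoly_smul hP.pderiv, norm_smul, norm_eq_of_mem_sphere,
    mul_one, Real.norm_of_nonneg hr.le, h]
  ring

/-- Each gradient is a radial part `α' r^m ξ P` plus `α r^(m-1) ∇P`. The sum over coordinates
collapses by `|ξ|² = 1` and `ξ · ∇P = m P`, so `A` and `B` depend on `r` alone. -/
theorem exists_sobolev_integrand_eq (V : ℝ → ℂ) {m n : ℕ} {P Q : MvPolynomial (Fin d) ℂ}
    (hP : P.IsHomogeneous m) (hQ : Q.IsHomogeneous n) {r : ℝ} (hr : 0 < r) :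
    ∃ A B : ℂ, ∀ ξ : Sph d,
      formalFun d V n Q (r • (ξ : Rd d)) * conj (formalFun d V m P (r • (ξ : Rd d))) +
        ∑ i, formalGrad d V n Q i (r • (ξ : Rd d)) *
          conj (formalGrad d V m P i (r • (ξ : Rd d))) =
      A * evalPoly (Q * MvPolynomial.map (starRingEnd ℂ) P) ξ +
        B * evalPoly (∑ i, MvPolynomial.pderiv i Q *
          MvPolynomial.pderiv i (MvPolynomial.map (starRingEnd ℂ) P)) ξ := by
  set a₁ : ℂ := radialSol d V n r * r ^ (n - 1)
  set b₁ : ℂ := radialDeriv d V n r * r ^ n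
  set a₂ : ℂ := conj (radialSol d V m r * r ^ (m - 1))
  set b₂ : ℂ := conj (radialDeriv d V m r * r ^ m)
  refine ⟨radialSol d V n r * r ^ n * conj (radialSol d V m r * r ^ m) +
    (b₁ * b₂ + b₁ * a₂ * m + a₁ * b₂ * n), a₁ * a₂, fun ξ => ?_⟩
  set P' := MvPolynomial.map (starRingEnd ℂ) P
  have hP' : P'.IsHomogeneous m := hP.map _
  have e : ∀ i, formalGrad d V n Q i (r • (ξ : Rd d)) *
      conj (formalGrad d V m P i (r • (ξ : Rd d))) =
      b₁ * b₂ * (evalPoly Q ξ * evalPoly P' ξ) * (((ξ : Rd d) i : ℂ) * ((ξ : Rd d) i : ℂ)) +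
      b₁ * a₂ * evalPoly Q ξ *
        (((ξ : Rd d) i : ℂ) * evalPoly (MvPolynomial.pderiv i P') ξ) +
      a₁ * b₂ * evalPoly P' ξ * (((ξ : Rd d) i : ℂ) * evalPoly (MvPolynomial.pderiv i Q) ξ) +
      a₁ * a₂ * (evalPoly (MvPolynomial.pderiv i Q) ξ *
        evalPoly (MvPolynomial.pderiv i P') ξ) := by
    intro i
    rw [formalGrad_smul_sphere V hP i hr, formalGrad_smul_sphere V hQ i hr, map_add,
      map_mul _ (radialDeriv d V m r * r ^ m), map_mul _ (radialSol d V m r * r ^ (m - 1)),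
      map_mul _ ((ξ : Rd d) i : ℂ), Complex.conj_ofReal, evalPoly_conj_pderiv, ← evalPoly_conj]
    ring
  simp only [e, Finset.sum_add_distrib, ← Finset.mul_sum]
  rw [sum_coord_sq, sum_coord_mul_evalPoly_pderiv hP', sum_coord_mul_evalPoly_pderiv hQ,
    formalFun_smul_sphere V hP hr, formalFun_smul_sphere V hQ hr,
    map_mul _ (radialSol d V m r * r ^ m), ← evalPoly_conj, evalPoly_sum, evalPoly_mul]
  simp only [evalPoly_mul]
  ring

theorem integrable_sphere_evalPoly (P : MvPolynomial (Fin d) ℂ) :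
    Integrable (fun ξ : Sph d => evalPoly P ξ) (surfaceMeasure d) :=
  ((continuous_evalPoly P).comp continuous_subtype_val).integrable_of_hasCompactSupport
    (HasCompactSupport.of_compactSpace _)

variable (hd : 3 ≤ d) {V : ℝ → ℂ}
  (hV : IntegrableOn (fun r : ℝ => (r : ℂ) * V r) (Set.Ioo 0 1))

include hd hV

theorem exists_represents {m : ℕ} {P : MvPolynomial (Fin d) ℂ} (hP : P.IsHomogeneous m) :
    ∃ f : W12 d, f.Represents (formalPolynomial d V m (restrictSphere d P)) :=
  ⟨W12.mk (formalFun d V m P) (formalGrad d V m P) (memLp_formalFun hd hV m P)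
    (memLp_formalGrad hd hV m P) (isWeakPartial_formalFun hd hV m P),
    (W12.mk_represents _ _ _ _ _).trans (formalPolynomial_ae_eq hd V hP).symm⟩

theorem grad_ae_eq {m : ℕ} {P : MvPolynomial (Fin d) ℂ} (hP : P.IsHomogeneous m) {f : W12 d}
    (hf : f.Represents (formalPolynomial d V m (restrictSphere d P))) (i : Fin d) :
    (f.grad i : Rd d → ℂ) =ᵐ[ballMeasure d] formalGrad d V m P i :=
  ((f.isWeakPartial i).congr (hf.trans (formalPolynomial_ae_eq hd V hP)) .rfl).unique
    (isWeakPartial_formalFun hd hV m P i) (f.integrable_grad i)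
    ((memLp_formalGrad hd hV m P i).integrable (by norm_num))

theorem inner_eq_zero_of_sphere {m n : ℕ} {P Q : MvPolynomial (Fin d) ℂ}
    (hP : P ∈ harmonicPolynomials d m) (hQ : Q ∈ harmonicPolynomials d n)
    (h0 : ∫ ξ : Sph d, evalPoly Q ξ * conj (evalPoly P ξ) ∂surfaceMeasure d = 0) {f g : W12 d}
    (hf : f.Represents (formalPolynomial d V m (restrictSphere d P)))
    (hg : g.Represents (formalPolynomial d V n (restrictSphere d Q))) :
    inner ℂ f g = 0 := by
  have hPh := (mem_harmonicPolynomials.1 hP).1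
  have hQh := (mem_harmonicPolynomials.1 hQ).1
  have hL2 : ∀ u v : L2Ball d, Integrable (fun x => v x * conj (u x)) (ballMeasure d) :=
    fun u v => by simpa only [RCLike.inner_apply] using L2.integrable_inner (𝕜 := ℂ) u v
  rw [W12.inner_eq, ← integral_finsetSum _ fun i _ => hL2 _ _,
    ← integral_add (hL2 _ _) (integrable_finsetSum _ fun i _ => hL2 _ _)]
  have hae : ∀ᵐ x ∂ballMeasure d, g.fn x * conj (f.fn x) + ∑ i, g.grad i x * conj (f.grad i x) =
      formalFun d V n Q x * conj (formalFun d V m P x) +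
        ∑ i, formalGrad d V n Q i x * conj (formalGrad d V m P i x) := by
    filter_upwards [hf.trans (formalPolynomial_ae_eq hd V hPh),
      hg.trans (formalPolynomial_ae_eq hd V hQh),
      ae_all_iff.2 (grad_ae_eq hd hV hPh hf), ae_all_iff.2 (grad_ae_eq hd hV hQh hg)]
      with x h1 h2 h3 h4
    simp only [h1, h2, h3, h4]
  rw [integral_congr_ae hae, ← integral_indicator measurableSet_ball]
  refine integral_eq_zero_of_sphere (by omega) fun r hr => ?_
  rcases lt_or_ge r 1 with hr1 | hr1
  · obtain ⟨A, B, hAB⟩ := exists_sobolev_integrand_eq V hPh hQh hr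
    have hmem : ∀ ξ : Sph d, r • (ξ : Rd d) ∈ ball (0 : Rd d) 1 := fun ξ => by
      rw [mem_ball_zero_iff, norm_smul, norm_eq_of_mem_sphere, mul_one, Real.norm_of_nonneg hr.le]
      exact hr1
    have h1 : ∫ ξ : Sph d, evalPoly (Q * MvPolynomial.map (starRingEnd ℂ) P) ξ
        ∂surfaceMeasure d = 0 := by
      simpa only [evalPoly_mul, evalPoly_conj] using h0
    have h2 := integral_sphere_grad_eq_zero (by omega) hQh
      (map_conj_mem_harmonicPolynomials hP) h1
    simp only [Set.indicator_of_mem (hmem _), hAB]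
    rw [integral_add ((integrable_sphere_evalPoly _).const_mul _)
      ((integrable_sphere_evalPoly _).const_mul _), integral_const_mul, integral_const_mul, h1, h2]
    simp
  · refine integral_eq_zero_of_ae (.of_forall fun ξ => Set.indicator_of_notMem ?_ _)
    rw [mem_ball_zero_iff, norm_smul, norm_eq_of_mem_sphere, mul_one, Real.norm_of_nonneg hr.le]
    exact not_lt.2 hr1

/-- By continuity the function vanishes everywhere in the ball. On a small sphere, where `α_m` is
near `α_m(0) = 1`, one may divide by `r^m α_m(r)`. -/
theorem eq_zero_of_formalPolynomial_ae_eq_zero {m : ℕ} {P : MvPolynomial (Fin d) ℂ}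
    (hP : P.IsHomogeneous m)
    (h : formalPolynomial d V m (restrictSphere d P) =ᵐ[ballMeasure d] 0) :
    restrictSphere d P = 0 := by
  have h1 : Set.EqOn (formalFun d V m P) 0 (ball 0 1) :=
    Measure.eqOn_open_of_ae_eq ((formalPolynomial_ae_eq hd V hP).symm.trans h) isOpen_ball
      (continuous_formalFun hd hV m P).continuousOn continuousOn_const
  have hne : ∀ᶠ r in nhdsWithin (0 : ℝ) (Set.Ioi 0), radialSol d V m r ≠ 0 := by
    refine nhdsWithin_le_nhds ((continuous_radialSol hd hV m).continuousAt.eventually_ne ?_)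
    rw [radialSol_zero hd hV m]
    exact one_ne_zero
  obtain ⟨r, hr, hr0, hr1⟩ := (hne.and (Ioo_mem_nhdsGT one_pos)).exists
  ext ξ
  have hmem : r • (ξ : Rd d) ∈ ball (0 : Rd d) 1 := by
    rw [mem_ball_zero_iff, norm_smul, norm_eq_of_mem_sphere, mul_one, Real.norm_of_nonneg hr0.le]
    exact hr1
  have h2 := h1 hmem
  rw [formalFun_smul_sphere V hP hr0] at h2
  have h3 : (r : ℂ) ^ m ≠ 0 := pow_ne_zero _ (by exact_mod_cast hr0.ne')
  have h4 : evalPoly P ξ = 0 := by simpa [hr, h3] using h2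
  exact h4

theorem exists_equiv_formalSpace (m : ℕ) :
    ∃ e : sphericalHarmonics d m ≃ₗ[ℂ] formalSpace d V m,
      ∀ p, (e p : W12 d).Represents (formalPolynomial d V m p) := by
  have hex : ∀ p : sphericalHarmonics d m, ∃ f : W12 d,
      f.Represents (formalPolynomial d V m p) := by
    rintro ⟨_, P, hP, rfl⟩
    exact exists_represents hd hV (mem_harmonicPolynomials.1 hP).1
  choose F hF using hex
  have hmem : ∀ p, F p ∈ formalSpace d V m := fun p => ⟨p, p.2, hF p⟩
  have hadd : ∀ p q, F (p + q) = F p + F q := fun p q => by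
    have h : formalPolynomial d V m (p + q : sphericalHarmonics d m) =
        formalPolynomial d V m p + formalPolynomial d V m q := formalPolynomial_add d V m p q
    exact W12.eq_of_represents (h ▸ hF (p + q)) ((Lp.coeFn_add _ _).trans ((hF p).add (hF q)))
  have hsmul : ∀ (c : ℂ) p, F (c • p) = c • F p := fun c p => by
    have h : formalPolynomial d V m (c • p : sphericalHarmonics d m) =
        c • formalPolynomial d V m p := formalPolynomial_smul d V m c p
    exact W12.eq_of_represents (h ▸ hF (c • p)) ((Lp.coeFn_smul c _).trans ((hF p).const_smul c))
  let L : sphericalHarmonics d m →ₗ[ℂ] formalSpace d V m :=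
    { toFun := fun p => ⟨F p, hmem p⟩
      map_add' := fun p q => Subtype.ext (hadd p q)
      map_smul' := fun c p => Subtype.ext (hsmul c p) }
  have hinj : Function.Injective L := by
    rw [← LinearMap.ker_eq_bot, LinearMap.ker_eq_bot']
    rintro ⟨_, P, hP, rfl⟩ h
    have h1 : F ⟨_, P, hP, rfl⟩ = 0 := congrArg Subtype.val h
    refine Subtype.ext (eq_zero_of_formalPolynomial_ae_eq_zero hd hV
      (mem_harmonicPolynomials.1 hP).1 ((hF ⟨_, P, hP, rfl⟩).symm.trans ?_))
    rw [h1]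
    exact Lp.coeFn_zero _ _ _
  have hsurj : Function.Surjective L := by
    rintro ⟨f, p, hp, hf⟩
    exact ⟨⟨p, hp⟩, Subtype.ext (W12.eq_of_represents (hF ⟨p, hp⟩) hf)⟩
  exact ⟨LinearEquiv.ofBijective L ⟨hinj, hsurj⟩, hF⟩

end Orthogonality

end FormalSpherical

end

theorem mainTheorem8 (d : ℕ) (hd : 3 ≤ d) (V : ℝ → ℂ)
    (hV : MeasureTheory.IntegrableOn (fun r : ℝ => (r : ℂ) * V r) (Set.Ioo 0 1)) :
    -- formal spherical polynomials belong to `W^{1,2}(B^d)`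
    (∀ (m : ℕ), ∀ p ∈ FormalSpherical.sphericalHarmonics d m,
      ∃ f : FormalSpherical.W12 d, f.Represents (FormalSpherical.formalPolynomial d V m p)) ∧
    -- (i) different degrees are orthogonal
    (∀ m n : ℕ, m ≠ n → FormalSpherical.formalSpace d V m ⟂ FormalSpherical.formalSpace d V n) ∧
    -- (ii) the functions `V_j = r^m α_m(r) Y_j` form an orthogonal basis of `S_m(B^d)`
    (∀ (m N : ℕ) (Y : Module.Basis (Fin N) ℂ (FormalSpherical.sphericalHarmonics d m)),
      FormalSpherical.IsOrthonormalOnSphere d (fun j => (Y j : FormalSpherical.Sph d → ℂ)) →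
      ∃ b : Module.Basis (Fin N) ℂ (FormalSpherical.formalSpace d V m),
        (∀ j, (b j : FormalSpherical.W12 d).Represents
          (FormalSpherical.formalPolynomial d V m (Y j))) ∧
        Pairwise fun j k => inner ℂ (b j) (b k) = 0) := by
  refine ⟨?_, ?_, ?_⟩
  · rintro m _ ⟨P, hP, rfl⟩
    exact FormalSpherical.exists_represents hd hV (FormalSpherical.mem_harmonicPolynomials.1 hP).1
  · intro m n hmn
    rw [Submodule.isOrtho_iff_inner_eq]
    rintro f ⟨_, ⟨P, hP, rfl⟩, hf⟩ g ⟨_, ⟨Q, hQ, rfl⟩, hg⟩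
    refine FormalSpherical.inner_eq_zero_of_sphere hd hV hP hQ ?_ hf hg
    simpa only [FormalSpherical.evalPoly_mul, FormalSpherical.evalPoly_conj] using
      FormalSpherical.integral_sphere_mul_eq_zero (by omega) hQ
        (FormalSpherical.map_conj_mem_harmonicPolynomials hP) hmn.symm
  · intro m N Y hY
    obtain ⟨e, he⟩ := FormalSpherical.exists_equiv_formalSpace hd hV m
    refine ⟨Y.map e, fun j => ?_, fun j k hjk => ?_⟩
    · rw [Module.Basis.map_apply]
      exact he (Y j)
    · obtain ⟨P, hP, hPj⟩ := (Y j).2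
      obtain ⟨Q, hQ, hQk⟩ := (Y k).2
      have hj := he (Y j)
      have hk := he (Y k)
      -- The indices are swapped because the inner product of `f` and `g` integrates `g` against the
      -- conjugate of `f`.
      have h0 := hY k j
      rw [if_neg hjk.symm] at h0
      simp only [← hPj, ← hQk] at hj hk h0
      rw [Submodule.coe_inner, Module.Basis.map_apply, Module.Basis.map_apply]
      exact FormalSpherical.inner_eq_zero_of_sphere hd hV hP hQ h0 hj hk
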